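/- Let $n \ge 2$ be even. Let $\sigma$ be a uniformly random perfect matching of the $3n$ mini-vertices $0,1,\dots,3n-1$, regarded as a fixed-point-free involution, and let $G_n$ be the random 3-regular multigraph on the vertices $0,\dots,n-1$ obtained by identifying, for each vertex $j$, the mini-vertices $3j,3j+1,3j+2$ with $j$ and keeping the edges of the matching (self-loops and multiple edges are allowed). Let $(\hat X^n_k)_{k\ge 0}$ be the discrete-time random walk on $G_n$ that starts from a given vertex $\hat X^n_0$ and at each step jumps from its current position $j$ to $\lfloor \sigma(3j+i)/3\rfloor$, where $i$ is chosen uniformly from $\{0,1,2\}$, the choices at different steps being independent of each other and of $\sigma$. Let $\hat D^n_k$ be the graph distance in $G_n$ between $\hat X^n_k$ and $\hat X^n_0$. Then for every fixed $t>0$, $$ \frac{\hat D^n_{\lfloor t\log_2 n\rfloor}}{\log_2 n} \to \min\left(\frac t3,1\right) $$ in probability as $n\to\infty$ through even integers, under the joint law of the matching and the walk, uniformly in the starting vertex. -/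

import Mathlib

open Filter MeasureTheory

/-- Perfect matchings of the `3n` mini-vertices `0, …, 3n - 1`: fixed-point-free involutions,
where `σ a` is the partner of `a`. -/
abbrev MiniMatching (n : ℕ) : Type :=
  {σ : Fin (3 * n) → Fin (3 * n) // Function.Involutive σ ∧ ∀ a, σ a ≠ a}

/-- The mini-vertex `3j + i` of the vertex `j`. -/
def miniVertex {n : ℕ} (j : Fin n) (i : Fin 3) : Fin (3 * n) :=
  ⟨3 * (j : ℕ) + (i : ℕ), by omega⟩

/-- The vertex `[a / 3]` to which the mini-vertex `a` belongs. -/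
def collapse {n : ℕ} (a : Fin (3 * n)) : Fin n :=
  ⟨(a : ℕ) / 3, by omega⟩

/-- The simple graph underlying the multigraph obtained from the matching `σ` by collapsing the
mini-vertices: two distinct vertices are adjacent when some mini-vertex of the first is matched
with some mini-vertex of the second. Self-loops and multiplicities of edges do not affect the
graph distance. -/
def matchingGraph {n : ℕ} (σ : MiniMatching n) : SimpleGraph (Fin n) where
  Adj u v := u ≠ v ∧ ∃ a : Fin (3 * n), collapse a = u ∧ collapse (σ.1 a) = v
  symm := ⟨by
    rintro u v ⟨huv, a, ha, hb⟩
    exact ⟨huv.symm, σ.1 a, hb, by rw [σ.2.1 a]; exact ha⟩⟩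
  loopless := ⟨fun _ h => h.1 rfl⟩

/-- The position at each time of the walk started at `x₀` on the graph of `σ`, where `ω k` is the
element of `{0, 1, 2}` chosen for step `k + 1`: the walk jumps from `j` to `[σ(3j + i) / 3]`. -/
def walk {n : ℕ} (σ : MiniMatching n) (x₀ : Fin n) (ω : ℕ → Fin 3) : ℕ → Fin n
  | 0 => x₀
  | k + 1 => collapse (σ.1 (miniVertex (walk σ x₀ ω k) (ω k)))

/-- The graph distance from the starting point at time `k`. -/
noncomputable def walkDist {n : ℕ} (σ : MiniMatching n) (x₀ : Fin n) (ω : ℕ → Fin 3) (k : ℕ) : ℕ :=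
  (matchingGraph σ).dist x₀ (walk σ x₀ ω k)

/-- The joint law of the uniformly random matching and of the independent sequence of independent
uniform choices in `{0, 1, 2}` that drives the walk. -/
noncomputable def walkMeasure (n : ℕ) : Measure (MiniMatching n × (ℕ → Fin 3)) :=
  (ProbabilityTheory.uniformOn (Set.univ : Set (MiniMatching n))).prod
    (Measure.infinitePi fun _ : ℕ => ProbabilityTheory.uniformOn (Set.univ : Set (Fin 3)))

/-! Reveal the matching edge by edge. Given the revealed part, the partner of an unmatched
mini-vertex is uniform among the remaining ones (`card_cyl_partner_mem`). Hence an exploration of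
`K` steps, with `K` of order `log n`, finds an edge to a visited vertex with probability `O(K² / n)`
(`card_collides_le`). Without such a collision it sees a tree, where a vertex determines its reduced
path (`eq_of_not_collides`).

Let `L = log₂ n`. Erasing backtracks from the trajectory gives a reduced path whose length, for
every fixed matching, is a walk on the naturals with steps `+1` and `-1` of probabilities `2/3` and
`1/3`, reflected at `0`. By Chebyshev it is close to `k / 3` at time `k`
(`sum_sq_reducedLength_le`), and it bounds the distance from above.

For the lower bound, suppose that the walk is within distance `ℓ` of its start although its reduced
path is longer. Then a second path, of length at most `ℓ`, has the same end, so exploring both gives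
a collision. About `2 ^ ℓ` such paths have to be tried, up to powers of `ℓ`, and the union bound `2
^ ℓ * L ^ 4 / n` vanishes for `ℓ ≤ (1 - ε) L` (`card_walk_mem_graphBall_le`).

The cap at `L` comes from joining two balls of radius slightly above `L / 2`. Both are likely to
have at least `2 ^ (r + 1)` exits (`card_ballExits_small_le`, a first-moment bound). Given the
balls, the exits fail to be joined with probability at most `exp (-c * 4 ^ r / n)`
(`card_far_apart_le`), which even beats a union over all `n` possible centres of the second ball. -/

/-! ### Uniform matchings conditioned on a revealed part -/

section Matchings

open Classical Finset

/-- Perfect matchings of `α`, as fixed-point-free involutions. -/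
abbrev PerfMatching (α : Type*) : Type _ :=
  {σ : α → α // Function.Involutive σ ∧ ∀ a, σ a ≠ a}

variable {α : Type*} [Fintype α]

noncomputable instance PerfMatching.fintype : Fintype (PerfMatching α) := Fintype.ofFinite _

/-- The matchings that agree with `σ₀` on `D`. -/
noncomputable def cyl (σ₀ : PerfMatching α) (D : Finset α) : Finset (PerfMatching α) :=
  univ.filter fun σ => ∀ a ∈ D, σ.1 a = σ₀.1 a

lemma mem_cyl {σ₀ σ : PerfMatching α} {D : Finset α} :
    σ ∈ cyl σ₀ D ↔ ∀ a ∈ D, σ.1 a = σ₀.1 a := by simp [cyl]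

/-- Conjugation of a matching by the transposition of `b` and `b'`. -/
noncomputable def conjSwap (b b' : α) (σ : PerfMatching α) : PerfMatching α :=
  ⟨fun a => Equiv.swap b b' (σ.1 (Equiv.swap b b' a)), fun a => by simp [σ.2.1 _], fun a h => by
    have := congrArg (Equiv.swap b b') h
    simp only [Equiv.swap_apply_self] at this
    exact σ.2.2 _ this⟩

omit [Fintype α] in
lemma conjSwap_conjSwap (b b' : α) (σ : PerfMatching α) :
    conjSwap b b' (conjSwap b b' σ) = σ := by
  apply Subtype.ext; funext a; simp [conjSwap]

lemma conjSwap_mem {σ₀ σ : PerfMatching α} {D : Finset α} (hD : ∀ a ∈ D, σ₀.1 a ∈ D)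
    {a b b' : α} (hb : b ∉ D) (hb' : b' ∉ D) (hab : a ≠ b) (hab' : a ≠ b')
    (h : σ ∈ cyl σ₀ D ∧ σ.1 a = b) :
    conjSwap b b' σ ∈ cyl σ₀ D ∧ (conjSwap b b' σ).1 a = b' := by
  obtain ⟨h1, h2⟩ := h
  rw [mem_cyl] at h1
  refine ⟨mem_cyl.2 fun c hc => ?_, ?_⟩
  · have hcb : c ≠ b := fun h => hb (h ▸ hc)
    have hcb' : c ≠ b' := fun h => hb' (h ▸ hc)
    have h3 := hD c hc
    simp only [conjSwap]
    rw [Equiv.swap_apply_of_ne_of_ne hcb hcb', h1 c hc,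
      Equiv.swap_apply_of_ne_of_ne (ne_of_mem_of_not_mem h3 hb)
        (ne_of_mem_of_not_mem h3 hb')]
  · simp only [conjSwap]
    rw [Equiv.swap_apply_of_ne_of_ne hab hab', h2, Equiv.swap_apply_left]

/-- Conjugation by the transposition of `b` and `b'` is an involution that moves the partner of `a`
and leaves the matching on `D` alone. -/
lemma card_cyl_partner_eq {σ₀ : PerfMatching α} {D : Finset α} (hD : ∀ a ∈ D, σ₀.1 a ∈ D)
    {a b b' : α} (hb : b ∉ D) (hb' : b' ∉ D) (hab : a ≠ b) (hab' : a ≠ b') :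
    #{σ ∈ cyl σ₀ D | σ.1 a = b} = #{σ ∈ cyl σ₀ D | σ.1 a = b'} := by
  refine card_bij' (fun σ _ => conjSwap b b' σ) (fun σ _ => conjSwap b b' σ) ?_ ?_ ?_ ?_
  · intro σ hσ
    exact mem_filter.2 (conjSwap_mem hD hb hb' hab hab' (mem_filter.1 hσ))
  · intro σ hσ
    have := conjSwap_mem hD hb' hb hab' hab (mem_filter.1 hσ)
    have e : conjSwap b' b σ = conjSwap b b' σ := by
      apply Subtype.ext; funext a; simp [conjSwap, Equiv.swap_comm b b']
    exact mem_filter.2 (e ▸ this)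
  · intro σ _; exact conjSwap_conjSwap _ _ _
  · intro σ _; exact conjSwap_conjSwap _ _ _

lemma partner_notMem {σ₀ σ : PerfMatching α} {D : Finset α} (hD : ∀ a ∈ D, σ₀.1 a ∈ D)
    (hσ : σ ∈ cyl σ₀ D) {a : α} (ha : a ∉ D) : σ.1 a ∉ insert a D := by
  rw [mem_insert, not_or]
  refine ⟨σ.2.2 a, fun h => ha ?_⟩
  have h1 := mem_cyl.1 hσ _ h
  rw [σ.2.1 a] at h1
  rw [h1]; exact hD _ h

/-- Given the matching on `D`, the partner of `a ∉ D` is uniform outside `insert a D`. -/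
lemma card_cyl_partner_mem {σ₀ : PerfMatching α} {D : Finset α} (hD : ∀ a ∈ D, σ₀.1 a ∈ D)
    {a : α} (ha : a ∉ D) (B : Finset α) :
    (Fintype.card α - (#D + 1)) * #{σ ∈ cyl σ₀ D | σ.1 a ∈ B} =
      #(B \ insert a D) * #(cyl σ₀ D) := by
  have key : ∀ B' : Finset α, #{σ ∈ cyl σ₀ D | σ.1 a ∈ B'} =
      ∑ b ∈ B' \ insert a D, #{σ ∈ cyl σ₀ D | σ.1 a = b} := by
    intro B'
    rw [card_eq_sum_card_fiberwise (f := fun σ => σ.1 a) (t := B' \ insert a D)]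
    · refine sum_congr rfl fun b hb => ?_
      congr 1; ext σ; simp only [mem_filter]
      constructor
      · rintro ⟨⟨h1, h2⟩, h3⟩; exact ⟨h1, h3⟩
      · rintro ⟨h1, h3⟩; exact ⟨⟨h1, h3 ▸ (mem_sdiff.1 hb).1⟩, h3⟩
    · intro σ hσ
      have hσ := mem_filter.1 hσ
      exact mem_sdiff.2 ⟨hσ.2, partner_notMem hD hσ.1 ha⟩
  have huniv := key univ
  rw [show ({σ ∈ cyl σ₀ D | σ.1 a ∈ univ}) = cyl σ₀ D by simp] at huniv
  have hN : #(univ \ insert a D) = Fintype.card α - (#D + 1) := by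
    rw [card_sdiff_of_subset (subset_univ _), card_univ, card_insert_of_notMem ha]
  rcases (univ \ insert a D).eq_empty_or_nonempty with h0 | ⟨b₀, hb₀⟩
  -- With no point left for the partner of `a`, the cylinder itself is empty and both sides vanish.
  · have h1 : #(cyl σ₀ D) = 0 := by rw [huniv, h0]; simp
    rw [← hN, h0, h1]; simp
  · have hc : ∀ b, b ∉ insert a D → #{σ ∈ cyl σ₀ D | σ.1 a = b} =
        #{σ ∈ cyl σ₀ D | σ.1 a = b₀} := by
      intro b hb
      have hb₀ := (mem_sdiff.1 hb₀).2
      rw [mem_insert, not_or] at hb hb₀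
      exact card_cyl_partner_eq hD hb.2 hb₀.2 (Ne.symm hb.1) (Ne.symm hb₀.1)
    have h2 : ∀ B' : Finset α, #{σ ∈ cyl σ₀ D | σ.1 a ∈ B'} =
        #(B' \ insert a D) * #{σ ∈ cyl σ₀ D | σ.1 a = b₀} := by
      intro B'
      rw [key B', sum_congr rfl fun b hb => hc b (mem_sdiff.1 hb).2]; simp
    have h3 : #(cyl σ₀ D) = #(univ \ insert a D) * #{σ ∈ cyl σ₀ D | σ.1 a = b₀} := by
      rw [← h2 univ]; simp
    rw [h2 B, h3, ← hN]; ring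

/-- A bound that holds on every class of matchings with a common revealed part holds overall. -/
lemma card_le_of_card_cyl_le (D : PerfMatching α → Finset α)
    (hD : ∀ σ σ', (∀ a ∈ D σ, σ'.1 a = σ.1 a) → D σ' = D σ)
    (E : PerfMatching α → Prop) [DecidablePred E] (c : ℝ)
    (h : ∀ σ₀, (#{σ ∈ cyl σ₀ (D σ₀) | E σ} : ℝ) ≤ c * #(cyl σ₀ (D σ₀))) :
    (#{σ : PerfMatching α | E σ} : ℝ) ≤ c * Fintype.card (PerfMatching α) := by
  -- The key is the revealed part of the matching. By `hD` its fibres are exactly the cylinders, so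
  -- they partition the matchings.
  let key : PerfMatching α → Finset (α × α) := fun σ => (D σ).image fun a => (a, σ.1 a)
  have hkey : ∀ σ σ₀, key σ = key σ₀ ↔ σ ∈ cyl σ₀ (D σ₀) := by
    intro σ σ₀
    rw [mem_cyl]
    constructor
    · intro hk a ha
      have : (a, σ₀.1 a) ∈ key σ := hk ▸ mem_image_of_mem _ ha
      obtain ⟨b, _, hb⟩ := mem_image.1 this
      rw [Prod.mk.injEq] at hb
      rw [← hb.2, hb.1]
    · intro hk
      have := hD σ₀ σ hk
      simp only [key, this]
      exact image_congr fun a ha => by simp [hk a ha]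
  have hfib : ∀ σ₀, univ.filter (fun σ => key σ = key σ₀) = cyl σ₀ (D σ₀) := by
    intro σ₀; ext σ; simp [hkey]
  have h1 := card_eq_sum_card_fiberwise (f := key) (s := univ.filter E) (t := univ.image key)
    (fun σ _ => mem_image_of_mem _ (mem_univ σ))
  have h2 := card_eq_sum_card_fiberwise (f := key) (s := univ) (t := univ.image key)
    (fun σ _ => mem_image_of_mem _ (mem_univ σ))
  rw [← card_univ, h1, h2]
  push_cast
  rw [mul_sum]
  refine sum_le_sum fun κ hκ => ?_
  obtain ⟨σ₀, _, rfl⟩ := mem_image.1 hκ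
  have h3 := h σ₀
  rw [← hfib σ₀, filter_filter] at h3
  rw [filter_filter]
  simpa [and_comm] using h3

/-- Given the matching on `D`, no edge joins two disjoint sets `S` and `T` of unmatched points only
with exponentially small probability. -/
lemma card_cyl_no_edge_le (T : Finset α) (q : ℕ) :
    ∀ (σ₀ : PerfMatching α) (D S : Finset α), (∀ a ∈ D, σ₀.1 a ∈ D) → Disjoint S D →
      Disjoint T D → Disjoint S T → 2 * q ≤ #S →
      (#{σ ∈ cyl σ₀ D | ∀ s ∈ S, σ.1 s ∉ T} : ℝ) ≤
        (1 - (#T : ℝ) / Fintype.card α) ^ q * #(cyl σ₀ D) := by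
  induction q with
  | zero =>
    intro σ₀ D S _ _ _ _ _
    simpa using card_filter_le _ _
  | succ q ih =>
    intro σ₀ D S hD hSD hTD hST hq
    obtain ⟨a, ha⟩ : S.Nonempty := card_pos.1 (by omega)
    have haD : a ∉ D := disjoint_left.1 hSD ha
    have haT : a ∉ T := disjoint_left.1 hST ha
    have hT1 : (#T : ℝ) / Fintype.card α ≤ 1 :=
      div_le_one_of_le₀ (by exact_mod_cast card_le_univ T) (by positivity)
    have hfib : ∀ b ∉ T, (#{σ ∈ cyl σ₀ D | (∀ s ∈ S, σ.1 s ∉ T) ∧ σ.1 a = b} : ℝ) ≤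
        (1 - (#T : ℝ) / Fintype.card α) ^ q * #{σ ∈ cyl σ₀ D | σ.1 a = b} := by
      intro b hbT
      rcases ({σ ∈ cyl σ₀ D | σ.1 a = b} : Finset _).eq_empty_or_nonempty with h0 | ⟨σ₁, h₁⟩
      · have : ({σ ∈ cyl σ₀ D | (∀ s ∈ S, σ.1 s ∉ T) ∧ σ.1 a = b} : Finset _) ⊆ ∅ := by
          rw [← h0]; intro σ; simp only [mem_filter]; tauto
        rw [subset_empty.1 this, h0]; simp
      · obtain ⟨h₁, hb⟩ := mem_filter.1 h₁
        have hc : ({σ ∈ cyl σ₀ D | σ.1 a = b} : Finset _) = cyl σ₁ (insert a (insert b D)) := by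
          ext σ
          rw [mem_filter, mem_cyl, mem_cyl]
          rw [mem_cyl] at h₁
          constructor
          · rintro ⟨h, h'⟩ c hc
            rw [mem_insert, mem_insert] at hc
            rcases hc with rfl | rfl | hc
            · rw [h', hb]
            · rw [← h', σ.2.1 a, h', ← hb, σ₁.2.1 a]
            · rw [h c hc, h₁ c hc]
          · intro h
            refine ⟨fun c hc => ?_, ?_⟩
            · rw [h c (by simp [hc]), h₁ c hc]
            · rw [h a (by simp), hb]
        -- Revealing one edge may use up two points of `S`, namely `a` and its partner `b`; hence `2
        -- * q ≤ #S`. The set `T` stays unmatched because `b ∉ T`.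
        have h2 := ih σ₁ (insert a (insert b D)) ((S.erase a).erase b) ?_ ?_ ?_ ?_ ?_
        · rw [hc]
          refine le_trans ?_ h2
          rw [← hc, filter_filter]
          norm_cast
          apply card_le_card
          intro σ
          simp only [mem_filter, mem_erase]
          rintro ⟨h3, h4, h5⟩
          exact ⟨h3, h5, fun s hs => h4 s hs.2.2⟩
        · intro c hc
          rw [mem_insert, mem_insert] at hc
          rcases hc with rfl | rfl | hc
          · rw [hb]; simp
          · rw [← hb, σ₁.2.1 a]; simp
          · rw [mem_cyl.1 h₁ c hc]; simp [hD c hc]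
        · rw [disjoint_left]; intro c hc
          simp only [mem_erase] at hc
          simp only [mem_insert, not_or]
          exact ⟨hc.2.1, hc.1, disjoint_left.1 hSD hc.2.2⟩
        · rw [disjoint_left]; intro c hc
          simp only [mem_insert, not_or]
          exact ⟨fun h => haT (h ▸ hc), fun h => hbT (h ▸ hc), disjoint_left.1 hTD hc⟩
        · exact hST.mono_left ((erase_subset _ _).trans (erase_subset _ _))
        · have := pred_card_le_card_erase (s := S.erase a) (a := b)
          rw [card_erase_of_mem ha] at this
          omega
    have hsum : (#{σ ∈ cyl σ₀ D | ∀ s ∈ S, σ.1 s ∉ T} : ℝ) ≤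
        (1 - (#T : ℝ) / Fintype.card α) ^ q * #{σ ∈ cyl σ₀ D | σ.1 a ∉ T} := by
      rw [card_eq_sum_card_fiberwise (f := fun σ => σ.1 a) (t := Tᶜ) fun σ hσ => by
          simpa using (mem_filter.1 hσ).2 a ha,
        card_eq_sum_card_fiberwise (f := fun σ => σ.1 a) (t := Tᶜ)
          (s := {σ ∈ cyl σ₀ D | σ.1 a ∉ T}) fun σ hσ => by
            simpa using (mem_filter.1 hσ).2]
      push_cast
      rw [mul_sum]
      refine sum_le_sum fun b hb => ?_
      have hbT : b ∉ T := by simpa using hb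
      rw [filter_filter, filter_filter]
      refine (hfib b hbT).trans (le_of_eq ?_)
      congr 3
      ext σ; simp only [mem_filter]
      constructor
      · rintro ⟨h, rfl⟩; exact ⟨h, hbT, rfl⟩
      · rintro ⟨h, _, h'⟩; exact ⟨h, h'⟩
    have hstep : (#{σ ∈ cyl σ₀ D | σ.1 a ∉ T} : ℝ) ≤
        (1 - (#T : ℝ) / Fintype.card α) * #(cyl σ₀ D) := by
      have h1 := card_cyl_partner_mem hD haD T
      have hTs : T \ insert a D = T := by
        rw [Finset.sdiff_eq_self_iff_disjoint, disjoint_left]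
        intro c hc hc'
        rcases mem_insert.1 hc' with rfl | h
        · exact haT hc
        · exact disjoint_left.1 hTD hc h
      rw [hTs] at h1
      have h2 := card_filter_add_card_filter_not (s := cyl σ₀ D) (fun σ => σ.1 a ∈ T)
      have hN : 0 < Fintype.card α := Fintype.card_pos_iff.2 ⟨a⟩
      -- Counting the already matched points among the possible partners only lowers the chance of
      -- hitting `T`, and makes the bound independent of `D`.
      have h3 : #T * #(cyl σ₀ D) ≤ Fintype.card α * #{σ ∈ cyl σ₀ D | σ.1 a ∈ T} := by
        rw [← h1]; exact Nat.mul_le_mul_right _ (Nat.sub_le _ _)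
      have h4 : (#T : ℝ) * #(cyl σ₀ D) ≤
          Fintype.card α * #{σ ∈ cyl σ₀ D | σ.1 a ∈ T} := by exact_mod_cast h3
      have h5 : (#{σ ∈ cyl σ₀ D | σ.1 a ∈ T} : ℝ) + #{σ ∈ cyl σ₀ D | σ.1 a ∉ T} =
          #(cyl σ₀ D) := by exact_mod_cast h2
      have hN' : (0 : ℝ) < Fintype.card α := by exact_mod_cast hN
      rw [sub_mul, one_mul, ← h5, div_mul_eq_mul_div, h5]
      have := (div_le_iff₀' hN').2 h4
      linarith
    calc _ ≤ _ := hsum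
      _ ≤ (1 - (#T : ℝ) / Fintype.card α) ^ q * ((1 - (#T : ℝ) / Fintype.card α) *
            #(cyl σ₀ D)) := by
          gcongr
      _ = _ := by ring

end Matchings

/-! ### Explorations of the multigraph and their collisions -/

section Exploration

open Classical Finset

variable {n : ℕ}

/-- The vertex at the end of a path from `x₀`, given as the list of the mini-vertices through which
the path enters its vertices, the last one first. -/
def pathEnd (x₀ : Fin n) : List (Fin (3 * n)) → Fin n
  | [] => x₀
  | e :: _ => collapse e

/-- Leave the end of the path `s` through the mini-vertex `a`, backtracking if `s` came through
`a`. -/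
noncomputable def pathStep (σ : MiniMatching n) (s : List (Fin (3 * n))) (a : Fin (3 * n)) :
    List (Fin (3 * n)) :=
  if s.head? = some a then s.tail else σ.1 a :: s

/-- The list of entering mini-vertices of a path without backtracking. -/
def IsReducedPath (σ : MiniMatching n) (x₀ : Fin n) : List (Fin (3 * n)) → Prop
  | [] => True
  | e :: s => collapse (σ.1 e) = pathEnd x₀ s ∧ s.head? ≠ some (σ.1 e) ∧ IsReducedPath σ x₀ s

lemma IsReducedPath.step {σ : MiniMatching n} {x₀ : Fin n} {s : List (Fin (3 * n))}
    (hs : IsReducedPath σ x₀ s) {a : Fin (3 * n)} (ha : collapse a = pathEnd x₀ s) :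
    IsReducedPath σ x₀ (pathStep σ s a) := by
  unfold pathStep
  split_ifs with h
  · cases s with
    | nil => trivial
    | cons e s => exact hs.2.2
  · exact ⟨by rw [σ.2.1 a, ha], by rwa [σ.2.1 a], hs⟩

lemma IsReducedPath.pathEnd_step {σ : MiniMatching n} {x₀ : Fin n} {s : List (Fin (3 * n))}
    (hs : IsReducedPath σ x₀ s) (a : Fin (3 * n)) :
    pathEnd x₀ (pathStep σ s a) = collapse (σ.1 a) := by
  unfold pathStep
  split_ifs with h
  · cases s with
    | nil => simp at h
    | cons e s =>
      obtain rfl : e = a := by simpa using h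
      exact hs.1.symm
  · rfl

/-- Stepping through an edge and back does nothing. -/
lemma IsReducedPath.step_step {σ : MiniMatching n} {x₀ : Fin n} {s : List (Fin (3 * n))}
    (hs : IsReducedPath σ x₀ s) (a : Fin (3 * n)) :
    pathStep σ (pathStep σ s a) (σ.1 a) = s := by
  by_cases h : s.head? = some a
  · cases s with
    | nil => simp at h
    | cons e s =>
      obtain rfl : e = a := by simpa using h
      simp [pathStep, hs.2.1, σ.2.1 e]
  · simp [pathStep, h]

/-- An exploration: instructions, the last one first, each of which chooses the mini-vertex through
which the current path is continued, or goes back to the root. -/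
abbrev Exploration (n : ℕ) : Type := List (List (Fin (3 * n)) → Option (Fin (3 * n)))

/-- The instructions choose mini-vertices of the current vertex. -/
def Exploration.Valid (x₀ : Fin n) (P : Exploration n) : Prop :=
  ∀ f ∈ P, ∀ s a, f s = some a → collapse a = pathEnd x₀ s

/-- The path after an exploration. -/
noncomputable def Exploration.path (σ : MiniMatching n) : Exploration n → List (Fin (3 * n))
  | [] => []
  | f :: P => (f (path σ P)).elim [] (pathStep σ (path σ P))

/-- The mini-vertices whose partners an exploration reveals, and these partners. -/
noncomputable def Exploration.revealed (σ : MiniMatching n) : Exploration n → Finset (Fin (3 * n))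
  | [] => ∅
  | f :: P => (f (path σ P)).elim ∅ (fun a => {a, σ.1 a}) ∪ revealed σ P

/-- The paths passed by an exploration. -/
noncomputable def Exploration.visited (σ : MiniMatching n) :
    Exploration n → Finset (List (Fin (3 * n)))
  | [] => {[]}
  | f :: P => insert (path σ (f :: P)) (visited σ P)

/-- After `P`, the instruction `f` reveals an edge to a vertex that was visited before. -/
def Exploration.CollidesAt (σ : MiniMatching n) (x₀ : Fin n)
    (f : List (Fin (3 * n)) → Option (Fin (3 * n))) (P : Exploration n) : Prop :=
  ∃ a, f (path σ P) = some a ∧ a ∉ revealed σ P ∧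
    ∃ s ∈ visited σ P, pathEnd x₀ s = collapse (σ.1 a)

/-- Some newly revealed edge leads to a vertex that was visited before. -/
def Exploration.Collides (σ : MiniMatching n) (x₀ : Fin n) : Exploration n → Prop
  | [] => False
  | f :: P => Collides σ x₀ P ∨ CollidesAt σ x₀ f P

namespace Exploration

variable {σ : MiniMatching n} {x₀ : Fin n}

lemma Valid.tail {f : List (Fin (3 * n)) → Option (Fin (3 * n))} {P : Exploration n}
    (h : Valid x₀ (f :: P)) : Valid x₀ P := fun g hg => h g (List.mem_cons_of_mem _ hg)

lemma Valid.append {P Q : Exploration n} (hP : Valid x₀ P) (hQ : Valid x₀ Q) :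
    Valid x₀ (P ++ Q) := fun f hf => (List.mem_append.1 hf).elim (hP f) (hQ f)

lemma Valid.cons {f : List (Fin (3 * n)) → Option (Fin (3 * n))} {P : Exploration n}
    (hf : ∀ s a, f s = some a → collapse a = pathEnd x₀ s) (h : Valid x₀ P) :
    Valid x₀ (f :: P) := by
  intro g hg
  rcases List.mem_cons.1 hg with rfl | hg
  · exact hf
  · exact h g hg

lemma nil_mem_visited (P : Exploration n) : [] ∈ visited σ P := by
  induction P with
  | nil => simp [visited]
  | cons f P ih => simp [visited, ih]

lemma path_mem_visited (P : Exploration n) : path σ P ∈ visited σ P := by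
  cases P <;> simp [visited, path]

lemma visited_subset_append (P Q : Exploration n) : visited σ Q ⊆ visited σ (P ++ Q) := by
  induction P with
  | nil => simp
  | cons f P ih => exact ih.trans (subset_insert _ _)

lemma card_visited_le (P : Exploration n) : #(visited σ P) ≤ P.length + 1 := by
  induction P with
  | nil => simp [visited]
  | cons f P ih => exact (card_insert_le _ _).trans (by simpa using ih)

lemma card_revealed_le (P : Exploration n) : #(revealed σ P) ≤ 2 * P.length := by
  induction P with
  | nil => simp [revealed]
  | cons f P ih =>
    refine (card_union_le _ _).trans ?_
    have : #((f (path σ P)).elim ∅ (fun a => {a, σ.1 a})) ≤ 2 := by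
      cases f (path σ P) with
      | none => simp
      | some a => exact card_le_two
    simp only [List.length_cons]; omega

lemma isReducedPath_of_mem_visited {P : Exploration n} (hP : Valid x₀ P)
    {s : List (Fin (3 * n))} (hs : s ∈ visited σ P) : IsReducedPath σ x₀ s := by
  induction P generalizing s with
  | nil =>
    obtain rfl : s = [] := by simpa [visited] using hs
    trivial
  | cons f P ih =>
    rcases mem_insert.1 hs with rfl | hs
    · have h1 := ih hP.tail (path_mem_visited P)
      simp only [path]
      cases hf : f (path σ P) with
      | none => trivial
      | some a => exact h1.step (hP f List.mem_cons_self _ _ hf)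
    · exact ih hP.tail hs

lemma exists_of_mem_revealed {P : Exploration n} (hP : Valid x₀ P) {a : Fin (3 * n)}
    (ha : a ∈ revealed σ P) : ∃ s ∈ visited σ P, ∃ b, collapse b = pathEnd x₀ s ∧
      pathStep σ s b ∈ visited σ P ∧ (a = b ∨ a = σ.1 b) := by
  induction P with
  | nil => simp [revealed] at ha
  | cons f P ih =>
    rcases mem_union.1 ha with ha | ha
    · cases hf : f (path σ P) with
      | none => simp [hf] at ha
      | some b =>
        refine ⟨_, mem_insert_of_mem (path_mem_visited P), b, hP f List.mem_cons_self _ _ hf,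
          mem_insert.2 (Or.inl ?_), by simpa [hf] using ha⟩
        simp [path, hf]
    · obtain ⟨s, hs, b, hb, h1, h2⟩ := ih hP.tail ha
      exact ⟨s, mem_insert_of_mem hs, b, hb, mem_insert_of_mem h1, h2⟩

lemma revealed_invariant {P : Exploration n} {a : Fin (3 * n)} (ha : a ∈ revealed σ P) :
    σ.1 a ∈ revealed σ P := by
  induction P with
  | nil => simp [revealed] at ha
  | cons f P ih =>
    rcases mem_union.1 ha with ha | ha
    · refine mem_union_left _ ?_
      cases hf : f (path σ P) with
      | none => simp [hf] at ha
      | some b =>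
        simp only [hf, Option.elim_some, mem_insert, mem_singleton] at ha ⊢
        rcases ha with rfl | rfl
        · simp
        · simp [σ.2.1 b]
    · exact mem_union_right _ (ih ha)

/-- An exploration without collisions sees a tree: a visited vertex determines the path to it. -/
theorem eq_of_not_collides {P : Exploration n} (hP : Valid x₀ P) (hc : ¬ Collides σ x₀ P)
    {s s' : List (Fin (3 * n))} (hs : s ∈ visited σ P) (hs' : s' ∈ visited σ P)
    (h : pathEnd x₀ s = pathEnd x₀ s') : s = s' := by
  induction P generalizing s s' with
  | nil => simp [visited] at hs hs'; rw [hs, hs']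
  | cons f P ih =>
    have hc' : ¬ Collides σ x₀ P := fun h => hc (Or.inl h)
    have ih := fun {s s'} => ih (s := s) (s' := s') hP.tail hc'
    have key : ∀ s' ∈ visited σ P, pathEnd x₀ (path σ (f :: P)) = pathEnd x₀ s' →
        path σ (f :: P) = s' := by
      intro s' hs' h
      have hred := isReducedPath_of_mem_visited hP.tail (path_mem_visited (σ := σ) P)
      have hf' : ∀ o, f (path σ P) = o → path σ (f :: P) = o.elim [] (pathStep σ (path σ P)) := by
        rintro o rfl; rfl
      cases hf : f (path σ P) with
      | none =>
        have h0 := hf' _ hf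
        simp only [Option.elim_none] at h0
        rw [h0] at h ⊢
        exact ih (nil_mem_visited P) hs' h
      | some a =>
        have h0 := hf' _ hf
        simp only [Option.elim_some] at h0
        have ha := hP f List.mem_cons_self _ _ hf
        have hend := hred.pathEnd_step a
        rw [h0, hend] at h
        -- An edge revealed earlier was crossed from a visited path `u`. By induction the current
        -- path is `u` or its continuation, so crossing the edge leads to a visited path again. A
        -- new edge to a visited vertex would be a collision.
        by_cases hr : a ∈ revealed σ P
        · obtain ⟨u, hu, b, hb, hub, hab⟩ := exists_of_mem_revealed hP.tail hr
          have hredu := isReducedPath_of_mem_visited hP.tail hu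
          rw [h0]
          rcases hab with rfl | rfl
          · have : path σ P = u := ih (path_mem_visited P) hu (by rw [← ha, hb])
            rw [this]
            exact ih hub hs' (by rw [hredu.pathEnd_step, h])
          · have : path σ P = pathStep σ u b :=
              ih (path_mem_visited P) hub (by rw [← ha, hredu.pathEnd_step])
            rw [this, hredu.step_step]
            exact ih hu hs' (by rw [← hb, ← h, σ.2.1 b])
        · exact absurd (Or.inr ⟨a, hf, hr, s', hs', h.symm⟩) hc
    rcases mem_insert.1 hs with rfl | hs
    · rcases mem_insert.1 hs' with rfl | hs'
      · rfl
      · exact key s' hs' h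
    · rcases mem_insert.1 hs' with rfl | hs'
      · exact (key s hs h.symm).symm
      · exact ih hs hs' h

/-- Instructions look only at the current path, so the run depends on the matching through the
revealed edges alone. This stopping-time property is what `card_le_of_card_cyl_le` requires. -/
lemma congr_of_agree {σ' : MiniMatching n} {P : Exploration n}
    (h : ∀ a ∈ revealed σ P, σ'.1 a = σ.1 a) :
    path σ' P = path σ P ∧ revealed σ' P = revealed σ P ∧ visited σ' P = visited σ P := by
  induction P with
  | nil => simp [path, revealed, visited]
  | cons f P ih =>
    obtain ⟨h1, h2, h3⟩ := ih fun a ha => h a (mem_union_right _ ha)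
    have h4 : path σ' (f :: P) = path σ (f :: P) := by
      simp only [path, h1]
      cases hf : f (path σ P) with
      | none => rfl
      | some a =>
        have := h a (mem_union_left _ (by simp [hf]))
        simp [pathStep, this]
    refine ⟨h4, ?_, by simp only [visited, h4, h3]⟩
    simp only [revealed, h1, h2]
    cases hf : f (path σ P) with
    | none => rfl
    | some a =>
      have := h a (mem_union_left _ (by simp [hf]))
      simp [this]

end Exploration

lemma collapse_miniVertex (j : Fin n) (i : Fin 3) : collapse (miniVertex j i) = j := by
  apply Fin.ext; simp only [collapse, miniVertex]; omega

/-- The position of a mini-vertex among the three of its vertex. -/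
def slot (a : Fin (3 * n)) : Fin 3 := ⟨(a : ℕ) % 3, by omega⟩

lemma miniVertex_collapse_slot (a : Fin (3 * n)) : miniVertex (collapse a) (slot a) = a := by
  apply Fin.ext; simp only [collapse, miniVertex, slot]; omega

lemma miniVertex_injective (j : Fin n) : Function.Injective (miniVertex j) := by
  intro i i' h
  have := congrArg Fin.val h
  simp only [miniVertex] at this
  apply Fin.ext; omega

lemma card_collapse_mem_le (V : Finset (Fin n)) : #{a : Fin (3 * n) | collapse a ∈ V} ≤ 3 * #V := by
  have : ({a : Fin (3 * n) | collapse a ∈ V} : Finset _) ⊆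
      (V ×ˢ (univ : Finset (Fin 3))).image fun q => miniVertex q.1 q.2 := by
    intro a ha
    rw [mem_filter] at ha
    exact mem_image.2 ⟨(collapse a, slot a), by simp [ha.2], miniVertex_collapse_slot a⟩
  refine (card_le_card this).trans (card_image_le.trans ?_)
  simp [mul_comm]

namespace Exploration

/-- At most `P.length + 1` vertices have been visited, with three mini-vertices each, while at least
`2 * n` partners are still available to a new mini-vertex. -/
lemma card_collidesAt_le (x₀ : Fin n) (f : List (Fin (3 * n)) → Option (Fin (3 * n)))
    (P : Exploration n) (hn : 2 * (P.length + 1) ≤ n) :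
    (#{σ : MiniMatching n | CollidesAt σ x₀ f P} : ℝ) ≤
      3 * (P.length + 1) / (2 * n) * Fintype.card (MiniMatching n) := by
  refine card_le_of_card_cyl_le (α := Fin (3 * n)) (fun σ => revealed σ P)
    (fun σ σ' h => (congr_of_agree h).2.1) (fun σ => CollidesAt σ x₀ f P) _ ?_
  intro σ₀
  have hcong : ∀ σ ∈ cyl σ₀ (revealed σ₀ P), _ := fun σ hσ => congr_of_agree (mem_cyl.1 hσ)
  by_cases hex : ∃ a, f (path σ₀ P) = some a ∧ a ∉ revealed σ₀ P
  · obtain ⟨a, hfa, ha⟩ := hex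
    set V := (visited σ₀ P).image (pathEnd x₀)
    have hV : #V ≤ P.length + 1 := card_image_le.trans (card_visited_le P)
    set B : Finset (Fin (3 * n)) := {b | collapse b ∈ V}
    have hB : #B ≤ 3 * (P.length + 1) := (card_collapse_mem_le V).trans (by omega)
    have hsub : ({σ ∈ cyl σ₀ (revealed σ₀ P) | CollidesAt σ x₀ f P} : Finset _) ⊆
        ({σ ∈ cyl σ₀ (revealed σ₀ P) | σ.1 a ∈ B} : Finset _) := by
      intro σ hσ
      obtain ⟨hσ, a', h1, h2, s, hs, h3⟩ := mem_filter.1 hσ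
      obtain ⟨e1, e2, e3⟩ := hcong σ hσ
      rw [e1, hfa, Option.some.injEq] at h1
      subst h1
      rw [e3] at hs
      exact mem_filter.2 ⟨hσ, mem_filter.2 ⟨mem_univ _, h3 ▸ mem_image_of_mem _ hs⟩⟩
    have h1 : (Fintype.card (Fin (3 * n)) - (#(revealed σ₀ P) + 1)) *
        #{σ ∈ cyl σ₀ (revealed σ₀ P) | σ.1 a ∈ B} =
        #(B \ insert a (revealed σ₀ P)) * #(cyl σ₀ (revealed σ₀ P)) := by
      convert card_cyl_partner_mem (fun a ha => revealed_invariant ha) ha B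
    have h2 : #(B \ insert a (revealed σ₀ P)) ≤ 3 * (P.length + 1) :=
      (card_le_card sdiff_subset).trans hB
    have h3 := card_revealed_le (σ := σ₀) P
    rw [Fintype.card_fin] at h1
    have h4 : 2 * n * #{σ ∈ cyl σ₀ (revealed σ₀ P) | σ.1 a ∈ B} ≤
        3 * (P.length + 1) * #(cyl σ₀ (revealed σ₀ P)) := by
      calc _ ≤ _ := Nat.mul_le_mul_right _ (show 2 * n ≤ 3 * n - (#(revealed σ₀ P) + 1) by omega)
        _ = _ := h1
        _ ≤ _ := Nat.mul_le_mul_right _ h2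
    have h5 : (2 * n : ℝ) * #{σ ∈ cyl σ₀ (revealed σ₀ P) | σ.1 a ∈ B} ≤
        3 * (P.length + 1) * #(cyl σ₀ (revealed σ₀ P)) := by exact_mod_cast h4
    have hn' : (0 : ℝ) < 2 * n := by
      have : 0 < n := by omega
      positivity
    refine le_trans (Nat.cast_le.2 (card_le_card hsub)) ?_
    rw [div_mul_eq_mul_div, le_div_iff₀' hn']
    exact h5
  · have : ({σ ∈ cyl σ₀ (revealed σ₀ P) | CollidesAt σ x₀ f P} : Finset _) = ∅ := by
      rw [filter_eq_empty_iff]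
      rintro σ hσ ⟨a, h1, h2, _⟩
      obtain ⟨e1, e2, e3⟩ := hcong σ hσ
      exact hex ⟨a, e1 ▸ h1, e2 ▸ h2⟩
    rw [this]
    simp only [card_empty, Nat.cast_zero]
    positivity

/-- An exploration of `K` steps meets a collision with probability `O(K² / n)`. -/
theorem card_collides_le (x₀ : Fin n) (P : Exploration n) (hn : 2 * P.length ≤ n) :
    (#{σ : MiniMatching n | Collides σ x₀ P} : ℝ) ≤
      2 * (P.length : ℝ) ^ 2 / n * Fintype.card (MiniMatching n) := by
  induction P with
  | nil =>
    have : ({σ : MiniMatching n | Collides σ x₀ []} : Finset _) = ∅ :=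
      filter_eq_empty_iff.2 fun σ _ h => h
    simp [this]
  | cons f P ih =>
    simp only [List.length_cons] at hn
    have h1 := ih (by omega)
    have h2 := card_collidesAt_le x₀ f P hn
    have h3 : #{σ : MiniMatching n | Collides σ x₀ (f :: P)} ≤
        #{σ : MiniMatching n | Collides σ x₀ P} + #{σ : MiniMatching n | CollidesAt σ x₀ f P} := by
      refine le_trans (card_le_card ?_) (card_union_le _ _)
      intro σ hσ
      rw [mem_union, mem_filter, mem_filter]
      exact (mem_filter.1 hσ).2.imp (fun h => ⟨mem_univ _, h⟩) fun h => ⟨mem_univ _, h⟩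
    have h4 : (#{σ : MiniMatching n | Collides σ x₀ (f :: P)} : ℝ) ≤
        #{σ : MiniMatching n | Collides σ x₀ P} + #{σ : MiniMatching n | CollidesAt σ x₀ f P} := by
      exact_mod_cast h3
    refine h4.trans ((add_le_add h1 h2).trans ?_)
    rw [← add_mul]
    gcongr
    have hn' : (0 : ℝ) < n := by
      have : 0 < n := by omega
      positivity
    rw [show (3 * ((P.length : ℝ) + 1) / (2 * n)) = (3 / 2 * (P.length + 1)) / n by
      field_simp, ← add_div]
    gcongr
    push_cast [List.length_cons]
    nlinarith [(Nat.cast_nonneg P.length : (0 : ℝ) ≤ P.length)]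

end Exploration

end Exploration

/-! ### Balls, and the paths without backtracking that reach them -/

section Balls

open Classical Finset

variable {n : ℕ}

/-- The vertices at distance at most `r` from `u`. -/
noncomputable def graphBall (σ : MiniMatching n) (u : Fin n) : ℕ → Finset (Fin n)
  | 0 => {u}
  | r + 1 => graphBall σ u r ∪
      (univ.filter fun a => collapse a ∈ graphBall σ u r).image fun a => collapse (σ.1 a)

lemma graphBall_subset_succ (σ : MiniMatching n) (u : Fin n) (r : ℕ) :
    graphBall σ u r ⊆ graphBall σ u (r + 1) := subset_union_left

lemma graphBall_mono (σ : MiniMatching n) (u : Fin n) : Monotone (graphBall σ u) :=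
  monotone_nat_of_le_succ (graphBall_subset_succ σ u)

lemma collapse_partner_mem_graphBall {σ : MiniMatching n} {u : Fin n} {r : ℕ} {a : Fin (3 * n)}
    (h : collapse a ∈ graphBall σ u r) : collapse (σ.1 a) ∈ graphBall σ u (r + 1) :=
  mem_union_right _ (mem_image.2 ⟨a, by simp [h], rfl⟩)

lemma mem_graphBall_succ {σ : MiniMatching n} {u w : Fin n} {r : ℕ} :
    w ∈ graphBall σ u (r + 1) ↔
      w ∈ graphBall σ u r ∨ ∃ a, collapse a ∈ graphBall σ u r ∧ collapse (σ.1 a) = w := by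
  simp [graphBall]

lemma exists_walk_of_mem_graphBall {σ : MiniMatching n} {u w : Fin n} {r : ℕ}
    (h : w ∈ graphBall σ u r) : ∃ p : (matchingGraph σ).Walk w u, p.length ≤ r := by
  induction r generalizing w with
  | zero =>
    obtain rfl : w = u := by simpa [graphBall] using h
    exact ⟨.nil, le_rfl⟩
  | succ r ih =>
    rcases mem_graphBall_succ.1 h with h | ⟨a, ha, rfl⟩
    · obtain ⟨p, hp⟩ := ih h
      exact ⟨p, hp.trans (Nat.le_succ r)⟩
    · obtain ⟨p, hp⟩ := ih ha
      by_cases hne : collapse (σ.1 a) = collapse a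
      · rw [hne]; exact ⟨p, hp.trans (Nat.le_succ r)⟩
      · have hadj : (matchingGraph σ).Adj (collapse (σ.1 a)) (collapse a) :=
          ⟨hne, σ.1 a, rfl, by rw [σ.2.1 a]⟩
        exact ⟨.cons hadj p, by simpa using hp⟩

lemma mem_graphBall_of_walk {σ : MiniMatching n} {u w : Fin n} (p : (matchingGraph σ).Walk w u) :
    w ∈ graphBall σ u p.length := by
  induction p with
  | nil => simp [graphBall]
  | @cons w v u h p ih =>
    obtain ⟨a, ha, hb⟩ := h.2
    have h1 : collapse (σ.1 a) ∈ graphBall σ u p.length := by rw [hb]; exact ih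
    have := collapse_partner_mem_graphBall h1
    rw [σ.2.1 a, ha] at this
    simpa using this

lemma dist_le_of_mem_graphBall {σ : MiniMatching n} {u w : Fin n} {r : ℕ}
    (h : w ∈ graphBall σ u r) : (matchingGraph σ).dist u w ≤ r := by
  obtain ⟨p, hp⟩ := exists_walk_of_mem_graphBall h
  rw [SimpleGraph.dist_comm]
  exact (SimpleGraph.dist_le p).trans hp

/-- Membership in some ball supplies reachability, without which `SimpleGraph.dist` would be `0` by
convention. -/
lemma mem_graphBall_dist {σ : MiniMatching n} {u w : Fin n} {r : ℕ}
    (h : w ∈ graphBall σ u r) : w ∈ graphBall σ u ((matchingGraph σ).dist u w) := by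
  obtain ⟨p, hp⟩ := exists_walk_of_mem_graphBall h
  obtain ⟨q, hq⟩ := SimpleGraph.Reachable.exists_walk_length_eq_dist ⟨p⟩
  rw [SimpleGraph.dist_comm, ← hq]
  exact mem_graphBall_of_walk q

lemma mem_graphBall_trans {σ : MiniMatching n} {u v w : Fin n} {r s : ℕ}
    (h : v ∈ graphBall σ u r) (h' : w ∈ graphBall σ v s) : w ∈ graphBall σ u (r + s) := by
  induction s generalizing w with
  | zero =>
    obtain rfl : w = v := by simpa [graphBall] using h'
    exact h
  | succ s ih =>
    rcases mem_graphBall_succ.1 h' with h' | ⟨a, ha, rfl⟩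
    · exact graphBall_mono σ u (Nat.le_succ _) (ih h')
    · exact collapse_partner_mem_graphBall (ih ha)

lemma mem_graphBall_symm {σ : MiniMatching n} {u v : Fin n} {r : ℕ}
    (h : v ∈ graphBall σ u r) : u ∈ graphBall σ v r := by
  obtain ⟨p, hp⟩ := exists_walk_of_mem_graphBall h
  have := mem_graphBall_of_walk p.reverse
  rw [SimpleGraph.Walk.length_reverse] at this
  exact graphBall_mono σ v hp this

lemma IsReducedPath.pathEnd_mem_graphBall {σ : MiniMatching n} {x₀ : Fin n}
    {s : List (Fin (3 * n))} (hs : IsReducedPath σ x₀ s) :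
    pathEnd x₀ s ∈ graphBall σ x₀ s.length := by
  induction s with
  | nil => simp [pathEnd, graphBall]
  | cons e s ih =>
    have := collapse_partner_mem_graphBall (hs.1.symm ▸ ih hs.2.2)
    rwa [σ.2.1 e] at this

lemma IsReducedPath.drop {σ : MiniMatching n} {x₀ : Fin n} {s : List (Fin (3 * n))}
    (hs : IsReducedPath σ x₀ s) (j : ℕ) : IsReducedPath σ x₀ (s.drop j) := by
  induction j generalizing s with
  | zero => simpa using hs
  | succ j ih =>
    cases s with
    | nil => simpa using hs
    | cons e s => exact ih hs.2.2

/-- One of the two other mini-vertices of the vertex of `a`. -/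
def turn (b : Bool) (a : Fin (3 * n)) : Fin (3 * n) :=
  miniVertex (collapse a) (slot a + cond b 1 2)

lemma collapse_turn (b : Bool) (a : Fin (3 * n)) : collapse (turn b a) = collapse a :=
  collapse_miniVertex _ _

lemma slot_miniVertex (j : Fin n) (i : Fin 3) : slot (miniVertex j i) = i :=
  miniVertex_injective j (by
    conv_rhs => rw [← miniVertex_collapse_slot (miniVertex j i), collapse_miniVertex])

lemma slot_turn (b : Bool) (a : Fin (3 * n)) : slot (turn b a) = slot a + cond b 1 2 :=
  slot_miniVertex _ _

lemma turn_ne (b : Bool) (a : Fin (3 * n)) : turn b a ≠ a := by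
  intro h
  have := congrArg slot h
  rw [slot_turn] at this
  exact (by decide : ∀ (b : Bool) (i : Fin 3), i + cond b 1 2 ≠ i) b _ this

lemma turn_left_injective (a : Fin (3 * n)) : Function.Injective fun b => turn b a := by
  intro b b' h
  have := congrArg slot h
  simp only [slot_turn] at this
  exact (by decide : ∀ (b b' : Bool) (i : Fin 3), i + cond b 1 2 = i + cond b' 1 2 → b = b')
    b b' _ this

lemma exists_turn_eq {a a' : Fin (3 * n)} (h : collapse a' = collapse a) (hne : a' ≠ a) :
    ∃ b, turn b a = a' := by
  have hs : slot a' ≠ slot a := fun hs => hne (by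
    rw [← miniVertex_collapse_slot a', ← miniVertex_collapse_slot a, h, hs])
  obtain ⟨b, hb⟩ : ∃ b : Bool, slot a + cond b 1 2 = slot a' := by
    revert hs
    generalize slot a = i
    generalize slot a' = i'
    revert i i'; decide
  exact ⟨b, by rw [turn, hb, ← h, miniVertex_collapse_slot]⟩

lemma exists_turn_miniVertex_eq (a : Fin (3 * n)) :
    ∃ i, turn true (miniVertex (collapse a) i) = a := by
  refine ⟨slot a - 1, ?_⟩
  rw [turn, collapse_miniVertex, slot_miniVertex]
  simp [miniVertex_collapse_slot]

/-- The continuation of a path without backtracking by a word of turns, the last one first; at the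
root the first turn is taken with respect to the mini-vertex in slot `i`. -/
def pushWord (σ : MiniMatching n) (x₀ : Fin n) (i : Fin 3) (s : List (Fin (3 * n))) :
    List Bool → List (Fin (3 * n))
  | [] => s
  | b :: β => σ.1 (turn b ((pushWord σ x₀ i s β).headD (miniVertex x₀ i))) :: pushWord σ x₀ i s β

lemma length_pushWord (σ : MiniMatching n) (x₀ : Fin n) (i : Fin 3) (s : List (Fin (3 * n)))
    (β : List Bool) : (pushWord σ x₀ i s β).length = β.length + s.length := by
  induction β with
  | nil => simp [pushWord]
  | cons b β ih => simp [pushWord, ih]; omega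

lemma pushWord_injective (σ : MiniMatching n) (x₀ : Fin n) (i : Fin 3) (s : List (Fin (3 * n))) :
    Function.Injective (pushWord σ x₀ i s) := by
  intro β β' h
  have hl := congrArg List.length h
  rw [length_pushWord, length_pushWord] at hl
  induction β generalizing β' with
  | nil =>
    cases β' with
    | nil => rfl
    | cons b' β' => simp only [List.length_nil, List.length_cons] at hl; omega
  | cons b β ih =>
    cases β' with
    | nil => simp only [List.length_nil, List.length_cons] at hl; omega
    | cons b' β' =>
      rw [pushWord, pushWord, List.cons.injEq] at h
      obtain ⟨h1, h2⟩ := h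
      have := ih h2 (by simp only [List.length_cons] at hl; omega)
      subst this
      rw [turn_left_injective _ (σ.2.1.injective h1)]

lemma collapse_headD (x₀ : Fin n) (i : Fin 3) (s : List (Fin (3 * n))) :
    collapse (s.headD (miniVertex x₀ i)) = pathEnd x₀ s := by
  cases s with
  | nil => exact collapse_miniVertex _ _
  | cons e s => rfl

lemma head?_ne_turn (x₀ : Fin n) (i : Fin 3) (s : List (Fin (3 * n))) (b : Bool) :
    s.head? ≠ some (turn b (s.headD (miniVertex x₀ i))) := by
  cases s with
  | nil => simp
  | cons e s => simpa using (turn_ne b e).symm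

lemma pathStep_turn (σ : MiniMatching n) (x₀ : Fin n) (i : Fin 3) (s : List (Fin (3 * n)))
    (b : Bool) : pathStep σ s (turn b (s.headD (miniVertex x₀ i))) =
      σ.1 (turn b (s.headD (miniVertex x₀ i))) :: s := if_neg (head?_ne_turn x₀ i s b)

lemma pathEnd_pushWord_mem_graphBall (σ : MiniMatching n) (x₀ : Fin n) (i : Fin 3)
    (s : List (Fin (3 * n))) (β : List Bool) :
    pathEnd x₀ (pushWord σ x₀ i s β) ∈ graphBall σ (pathEnd x₀ s) β.length := by
  induction β with
  | nil => simp [pushWord, graphBall]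
  | cons b β ih =>
    refine collapse_partner_mem_graphBall ?_
    rwa [collapse_turn, collapse_headD]

/-- The ball around the end of a path is reached by going back along the path and then along
another path without backtracking. -/
lemma exists_pushWord_of_mem_graphBall {σ : MiniMatching n} {x₀ w : Fin n}
    {s : List (Fin (3 * n))} (hs : IsReducedPath σ x₀ s) {l : ℕ}
    (hw : w ∈ graphBall σ (pathEnd x₀ s) l) :
    ∃ i j β, β.length + j ≤ l ∧ pathEnd x₀ (pushWord σ x₀ i (s.drop j) β) = w := by
  induction l generalizing w with
  | zero => exact ⟨0, 0, [], le_rfl, by simpa [graphBall, pushWord, eq_comm] using hw⟩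
  | succ l ih =>
    rcases mem_graphBall_succ.1 hw with hw | ⟨a, ha, rfl⟩
    · obtain ⟨i, j, β, h1, h2⟩ := ih hw
      exact ⟨i, j, β, h1.trans (Nat.le_succ l), h2⟩
    · obtain ⟨i, j, β, h1, h2⟩ := ih ha
      -- Here the edge at `a` is the last edge of the path: crossing it removes the last turn or, if
      -- the word is empty, one more edge of `s`.
      by_cases hh : (pushWord σ x₀ i (s.drop j) β).head? = some a
      · cases β with
        | nil =>
          refine ⟨i, j + 1, [], by simp only [List.length_nil] at h1 ⊢; omega, ?_⟩
          have hd := hs.drop j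
          simp only [pushWord] at hh ⊢
          rw [← List.tail_drop]
          generalize s.drop j = t at hh hd ⊢
          cases t with
          | nil => simp at hh
          | cons e t =>
            obtain rfl : e = a := by simpa using hh
            exact hd.1.symm
        | cons b β =>
          refine ⟨i, j, β, by simp only [List.length_cons] at h1; omega, ?_⟩
          rw [pushWord, List.head?_cons, Option.some.injEq] at hh
          rw [← hh, σ.2.1, collapse_turn, collapse_headD]
      · cases hq : pushWord σ x₀ i (s.drop j) β with
        | nil =>
          have hlen := congrArg List.length hq
          rw [length_pushWord] at hlen
          simp only [List.length_nil, Nat.add_eq_zero_iff, List.length_eq_zero_iff] at hlen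
          obtain ⟨rfl, hd⟩ := hlen
          -- At the root all three directions are possible, but a word offers two; the reference
          -- slot is still free, since no turn has been taken.
          obtain ⟨i', hi'⟩ := exists_turn_miniVertex_eq a
          rw [hq] at h2
          refine ⟨i', j, [true], by simp only [List.length_nil, List.length_singleton] at h1 ⊢; omega,
            ?_⟩
          have : collapse a = x₀ := h2.symm
          rw [this] at hi'
          simp [pushWord, hd, hi', pathEnd]
        | cons e t =>
          rw [hq] at hh h2
          have hne : a ≠ e := fun h => hh (by simp [h])
          obtain ⟨b, hb⟩ := exists_turn_eq (show collapse a = collapse e from h2.symm) hne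
          refine ⟨i, j, b :: β, by simp only [List.length_cons]; omega, ?_⟩
          simp [pushWord, hq, hb, pathEnd]

namespace Exploration

/-- Follow the random walk for `k` steps. -/
def followWalk (x₀ : Fin n) (ω : ℕ → Fin 3) : ℕ → Exploration n
  | 0 => []
  | k + 1 => (fun s => some (miniVertex (pathEnd x₀ s) (ω k))) :: followWalk x₀ ω k

/-- Go back `j` edges. -/
def goBack (n j : ℕ) : Exploration n := List.replicate j List.head?

/-- Follow a word of turns. -/
def followWord (x₀ : Fin n) (i : Fin 3) (β : List Bool) : Exploration n :=
  β.map fun b s => some (turn b (s.headD (miniVertex x₀ i)))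

/-- Explore `A`, and then `B` from the root. -/
def both (A B : Exploration n) : Exploration n := B ++ (fun _ => none) :: A

variable {σ : MiniMatching n} {x₀ : Fin n}

lemma length_followWalk (ω : ℕ → Fin 3) (k : ℕ) : (followWalk x₀ ω k).length = k := by
  induction k with
  | zero => rfl
  | succ k ih => simp [followWalk, ih]

lemma valid_nil : Valid x₀ [] := by simp [Valid]

lemma valid_followWalk (ω : ℕ → Fin 3) (k : ℕ) : Valid x₀ (followWalk x₀ ω k) := by
  induction k with
  | zero => exact valid_nil
  | succ k ih =>
    refine ih.cons fun s a h => ?_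
    rw [← Option.some.inj h, collapse_miniVertex]

lemma valid_goBack (j : ℕ) : Valid x₀ (goBack n j) := by
  intro f hf s a h
  obtain rfl := List.eq_of_mem_replicate hf
  cases s with
  | nil => simp at h
  | cons e s =>
    obtain rfl : e = a := by simpa using h
    rfl

lemma valid_followWord (i : Fin 3) (β : List Bool) : Valid x₀ (followWord x₀ i β) := by
  intro f hf s a h
  obtain ⟨b, _, rfl⟩ := List.mem_map.1 hf
  rw [← Option.some.inj h, collapse_turn, collapse_headD]

lemma Valid.both {A B : Exploration n} (hA : Valid x₀ A) (hB : Valid x₀ B) :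
    Valid x₀ (both A B) := hB.append (hA.cons (by simp))

lemma Valid.isReducedPath {P : Exploration n} (hP : Valid x₀ P) :
    IsReducedPath σ x₀ (path σ P) := isReducedPath_of_mem_visited hP (path_mem_visited P)

lemma path_goBack_append (j : ℕ) (P : Exploration n) :
    path σ (goBack n j ++ P) = (path σ P).drop j := by
  induction j with
  | zero => simp [goBack]
  | succ j ih =>
    rw [goBack, List.replicate_succ, List.cons_append, path, ← goBack, ih, ← List.tail_drop]
    generalize (path σ P).drop j = t
    cases t with
    | nil => simp
    | cons e t => simp [pathStep]

lemma path_followWord_append (i : Fin 3) (β : List Bool) (P : Exploration n) :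
    path σ (followWord x₀ i β ++ P) = pushWord σ x₀ i (path σ P) β := by
  induction β with
  | nil => rfl
  | cons b β ih =>
    rw [followWord, List.map_cons, List.cons_append, path, ← followWord, ih, Option.elim_some,
      pathStep_turn, pushWord]

lemma path_append_restart (A B : Exploration n) :
    path σ (B ++ (fun _ => none) :: A) = path σ B := by
  induction B with
  | nil => rfl
  | cons f B ih => rw [List.cons_append, path, ih, path]

lemma pathEnd_followWalk (ω : ℕ → Fin 3) (k : ℕ) :
    pathEnd x₀ (path σ (followWalk x₀ ω k)) = walk σ x₀ ω k := by
  induction k with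
  | zero => rfl
  | succ k ih =>
    rw [followWalk, path, Option.elim_some, (valid_followWalk ω k).isReducedPath.pathEnd_step, ih]
    rfl

/-- Running `B` after a restart puts the final paths of `A` and `B` into one visited tree, where
`eq_of_not_collides` compares them. -/
lemma path_eq_of_not_collides_both {A B : Exploration n} (hA : Valid x₀ A) (hB : Valid x₀ B)
    (hc : ¬ Collides σ x₀ (both A B)) (h : pathEnd x₀ (path σ A) = pathEnd x₀ (path σ B)) :
    path σ A = path σ B := by
  refine eq_of_not_collides (hA.both hB) hc ?_ ?_ h
  · exact visited_subset_append _ _ (mem_insert_of_mem (path_mem_visited A))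
  · have := path_mem_visited (σ := σ) (both A B)
    rwa [both, path_append_restart] at this

lemma card_collides_both_le (A B : Exploration n) {K : ℕ} (hK : A.length + B.length + 1 ≤ K)
    (hn : 2 * K ≤ n) :
    (#{σ : MiniMatching n | Collides σ x₀ (both A B)} : ℝ) ≤
      2 * (K : ℝ) ^ 2 / n * Fintype.card (MiniMatching n) := by
  have hl : (both A B).length ≤ K := by simp only [both, List.length_append, List.length_cons]; omega
  refine (card_collides_le x₀ (both A B) (by omega)).trans ?_
  gcongr

end Exploration

/-! ### Union bounds over short explorations -/

/-- Indices of the explorations that go back and then follow a word, in at most `m` steps. -/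
abbrev BranchIndex (m : ℕ) : Type := Fin 3 × Fin (m + 1) × Fin (m + 1) × (Fin m → Bool)

lemma card_branchIndex (m : ℕ) : Fintype.card (BranchIndex m) = 3 * (m + 1) ^ 2 * 2 ^ m := by
  simp; ring

/-- Follow the random walk for `k` steps, go back along the path, and then follow a word. -/
def branch (x₀ : Fin n) (ω : ℕ → Fin 3) (k : ℕ) {m : ℕ} (q : BranchIndex m) : Exploration n :=
  Exploration.followWord x₀ q.1 ((List.ofFn q.2.2.2).take q.2.2.1) ++
    (Exploration.goBack n q.2.1 ++ Exploration.followWalk x₀ ω k)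

lemma length_branch_le (x₀ : Fin n) (ω : ℕ → Fin 3) (k : ℕ) {m : ℕ} (q : BranchIndex m) :
    (branch x₀ ω k q).length ≤ 2 * m + k := by
  simp only [branch, Exploration.followWord, Exploration.goBack, List.length_append,
    List.length_map, List.length_take, List.length_ofFn, List.length_replicate,
    Exploration.length_followWalk]
  omega

lemma valid_branch (x₀ : Fin n) (ω : ℕ → Fin 3) (k : ℕ) {m : ℕ} (q : BranchIndex m) :
    Exploration.Valid x₀ (branch x₀ ω k q) :=
  (Exploration.valid_followWord _ _).append
    ((Exploration.valid_goBack _).append (Exploration.valid_followWalk _ _))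

/-- The word is padded to length `m` and truncated again. The index does not depend on the matching,
as a union bound over indices requires. -/
lemma exists_branch_path_eq (x₀ : Fin n) (ω : ℕ → Fin 3) (k : ℕ) {m : ℕ} (i : Fin 3) {j : ℕ}
    {β : List Bool} (h : β.length + j ≤ m) : ∃ q : BranchIndex m, ∀ σ : MiniMatching n,
      Exploration.path σ (branch x₀ ω k q) =
        pushWord σ x₀ i ((Exploration.path σ (Exploration.followWalk x₀ ω k)).drop j) β := by
  refine ⟨(i, ⟨j, by omega⟩, ⟨β.length, by omega⟩, fun t => β.getD t false), fun σ => ?_⟩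
  have : (List.ofFn fun t : Fin m => β.getD t false).take β.length = β := by
    apply List.ext_getElem
    · simp; omega
    · intro t h1 h2
      simp [h2]
  simp only [branch]
  rw [Exploration.path_followWord_append, Exploration.path_goBack_append, this]

open Exploration in
/-- If the walk is in the ball of radius `ℓ` although its reduced path is longer, then there is a
collision with one of about `2 ^ ℓ` short explorations. -/
theorem card_walk_mem_graphBall_le (x₀ : Fin n) (ω : ℕ → Fin 3) (k ℓ : ℕ) {K : ℕ}
    (hK : k + 2 * ℓ + 1 ≤ K) (hn : 2 * K ≤ n) :
    (#{σ : MiniMatching n | walk σ x₀ ω k ∈ graphBall σ x₀ ℓ ∧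
        ℓ < (path σ (followWalk x₀ ω k)).length} : ℝ) ≤
      (3 * (ℓ + 1) ^ 2 * 2 ^ ℓ) * (2 * (K : ℝ) ^ 2 / n) * Fintype.card (MiniMatching n) := by
  have hsub : ({σ : MiniMatching n | walk σ x₀ ω k ∈ graphBall σ x₀ ℓ ∧
      ℓ < (path σ (followWalk x₀ ω k)).length} : Finset _) ⊆
      (univ : Finset (BranchIndex ℓ)).biUnion fun q =>
        {σ : MiniMatching n | Collides σ x₀ (both (followWalk x₀ ω k) (branch x₀ ω 0 q))} := by
    intro σ hσ
    obtain ⟨_, h1, h2⟩ := mem_filter.1 hσ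
    obtain ⟨i, j, β, h3, h4⟩ :=
      -- Starting from the empty path, the ball around `x₀` is described by words alone; accordingly
      -- the branch follows the walk for `0` steps.
      exists_pushWord_of_mem_graphBall (s := []) (x₀ := x₀) (by trivial) h1
    obtain ⟨q, hq⟩ := exists_branch_path_eq x₀ ω 0 i h3
    refine mem_biUnion.2 ⟨q, mem_univ _, mem_filter.2 ⟨mem_univ _, ?_⟩⟩
    by_contra hc
    have h5 := path_eq_of_not_collides_both (valid_followWalk _ _) (valid_branch _ _ _ _) hc (by
      rw [pathEnd_followWalk, hq]; exact h4.symm)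
    have h6 := congrArg List.length h5
    rw [hq, length_pushWord] at h6
    simp [followWalk, path] at h6
    omega
  refine (Nat.cast_le.2 ((card_le_card hsub).trans card_biUnion_le)).trans ?_
  push_cast
  refine (sum_le_card_nsmul _ _ _ fun q _ => card_collides_both_le (K := K) _ _ ?_ hn).trans
    (le_of_eq ?_)
  · have := length_branch_le x₀ ω 0 q
    rw [length_followWalk]; omega
  · rw [card_univ, card_branchIndex, nsmul_eq_mul]
    push_cast; ring

/-- The mini-vertices through which edges leave the ball of radius `r` around `u`. -/
noncomputable def ballExits (σ : MiniMatching n) (u : Fin n) (r : ℕ) : Finset (Fin (3 * n)) :=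
  {a | collapse a ∈ graphBall σ u r ∧ collapse (σ.1 a) ∉ graphBall σ u r}

-- A collision-free word of `r + 1` turns ends outside the ball: a shorter way to its end would be
-- the same path, by comparison of lengths. Its last edge is therefore an exit, and different such
-- words give different exits. The comparison with another word of full length in the injectivity
-- step is why branches of `r + 1` steps are allowed.
open Exploration in
lemma card_not_collides_le_card_ballExits (σ : MiniMatching n) (x₀ : Fin n) (ω : ℕ → Fin 3)
    (k r : ℕ) :
    #{p : Fin (r + 1) → Bool | ∀ q : BranchIndex (r + 1), ¬ Collides σ x₀
        (both (followWord x₀ 0 (List.ofFn p) ++ followWalk x₀ ω k) (branch x₀ ω k q))} ≤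
      #(ballExits σ (walk σ x₀ ω k) r) := by
  set s := path σ (followWalk x₀ ω k) with hs
  have hpath : ∀ p : Fin (r + 1) → Bool, path σ
      (followWord x₀ 0 (List.ofFn p) ++ followWalk x₀ ω k) = pushWord σ x₀ 0 s (List.ofFn p) :=
    fun p => path_followWord_append _ _ _
  have hvalid : ∀ p : Fin (r + 1) → Bool, Valid x₀
      (followWord x₀ 0 (List.ofFn p) ++ followWalk x₀ ω k) :=
    fun p => (valid_followWord _ _).append (valid_followWalk _ _)
  have hred : IsReducedPath σ x₀ s := (valid_followWalk ω k).isReducedPath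
  have hend : pathEnd x₀ s = walk σ x₀ ω k := pathEnd_followWalk ω k
  have key : ∀ p : Fin (r + 1) → Bool, (∀ q : BranchIndex (r + 1), ¬ Collides σ x₀
        (both (followWord x₀ 0 (List.ofFn p) ++ followWalk x₀ ω k) (branch x₀ ω k q))) →
      ∀ i j β, β.length + j ≤ r + 1 →
        pathEnd x₀ (pushWord σ x₀ 0 s (List.ofFn p)) =
          pathEnd x₀ (pushWord σ x₀ i (s.drop j) β) →
        pushWord σ x₀ 0 s (List.ofFn p) = pushWord σ x₀ i (s.drop j) β := by
    intro p hp i j β hβ h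
    obtain ⟨q, hq⟩ := exists_branch_path_eq x₀ ω k i hβ
    have := path_eq_of_not_collides_both (hvalid p) (valid_branch _ _ _ _) (hp q) (by
      rw [hpath, hq, h])
    rwa [hpath, hq] at this
  have hcons : ∀ p : Fin (r + 1) → Bool, ∃ a β, β.length = r ∧
      pushWord σ x₀ 0 s (List.ofFn p) = σ.1 a :: pushWord σ x₀ 0 s β ∧
      collapse a = pathEnd x₀ (pushWord σ x₀ 0 s β) := by
    intro p
    rw [List.ofFn_succ]
    exact ⟨_, _, List.length_ofFn, rfl, by rw [collapse_turn, collapse_headD]⟩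
  choose f g hg hf hf' using hcons
  refine card_le_card_of_injOn f ?_ ?_
  · intro p hp
    have hp := (mem_filter.1 hp).2
    refine mem_coe.2 (mem_filter.2 ⟨mem_univ _, ?_, fun hmem => ?_⟩)
    · rw [hf' p, ← hend]
      have := pathEnd_pushWord_mem_graphBall σ x₀ 0 s (g p)
      rwa [hg p] at this
    · rw [← hend] at hmem
      obtain ⟨i, j, β, h1, h2⟩ := exists_pushWord_of_mem_graphBall hred hmem
      have h3 := congrArg List.length
        (key p hp i j β (by omega) (by rw [hf p, h2]; rfl))
      rw [length_pushWord, length_pushWord, List.length_ofFn, List.length_drop] at h3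
      omega
  · intro p hp p' _ h
    have hp := (mem_filter.1 hp).2
    have h1 := key p hp 0 0 (List.ofFn p') (by simp) (by
      rw [List.drop_zero, hf p, hf p', h]; rfl)
    exact List.ofFn_injective (pushWord_injective _ _ _ _ h1)

open Exploration in
/-- The number of exits of the ball around the position of the walk is at least `2 ^ r` with high
probability, as long as `2 ^ r` is small compared to `n`. -/
theorem card_ballExits_small_le (x₀ : Fin n) (ω : ℕ → Fin 3) (k r : ℕ) {K : ℕ}
    (hK : 2 * k + 3 * (r + 1) + 1 ≤ K) (hn : 2 * K ≤ n) :
    (#{σ : MiniMatching n | #(ballExits σ (walk σ x₀ ω k) r) < 2 ^ r} : ℝ) ≤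
      2 * (3 * (r + 2) ^ 2 * 2 ^ (r + 1)) * (2 * (K : ℝ) ^ 2 / n) *
        Fintype.card (MiniMatching n) := by
  let A : (Fin (r + 1) → Bool) → Exploration n := fun p =>
    followWord x₀ 0 (List.ofFn p) ++ followWalk x₀ ω k
  let bad : MiniMatching n → Finset ((Fin (r + 1) → Bool) × BranchIndex (r + 1)) := fun σ =>
    {pq | Collides σ x₀ (both (A pq.1) (branch x₀ ω k pq.2))}
  -- Fewer than `2 ^ r` exits force at least half of the `2 ^ (r + 1)` words to collide. Markov's
  -- inequality for the number of bad pairs then saves a factor `2 ^ r` over a union bound, which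
  -- would be useless once `4 ^ r` exceeds `n`.
  have h1 : ∀ σ : MiniMatching n, #(ballExits σ (walk σ x₀ ω k) r) < 2 ^ r → 2 ^ r ≤ #(bad σ) := by
    intro σ hσ
    have h2 := card_not_collides_le_card_ballExits σ x₀ ω k r
    have h3 := card_filter_add_card_filter_not (s := (univ : Finset (Fin (r + 1) → Bool)))
      (fun p => ∀ q : BranchIndex (r + 1), ¬ Collides σ x₀ (both (A p) (branch x₀ ω k q)))
    have h4 : #{p : Fin (r + 1) → Bool | ¬ ∀ q : BranchIndex (r + 1),
        ¬ Collides σ x₀ (both (A p) (branch x₀ ω k q))} ≤ #(bad σ) := by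
      refine (card_le_card ?_).trans (card_image_le (f := Prod.fst) (s := bad σ))
      intro p hp
      have hp := (mem_filter.1 hp).2
      push Not at hp
      obtain ⟨q, hq⟩ := hp
      exact mem_image.2 ⟨(p, q), mem_filter.2 ⟨mem_univ _, hq⟩, rfl⟩
    have h5 : #(univ : Finset (Fin (r + 1) → Bool)) = 2 ^ r * 2 := by simp [pow_succ]
    rw [h5] at h3
    have h6 : #{p : Fin (r + 1) → Bool | ∀ q : BranchIndex (r + 1),
        ¬ Collides σ x₀ (both (A p) (branch x₀ ω k q))} < 2 ^ r := lt_of_le_of_lt h2 hσ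
    omega
  have h2 : 2 ^ r * #{σ : MiniMatching n | #(ballExits σ (walk σ x₀ ω k) r) < 2 ^ r} ≤
      ∑ σ, #(bad σ) := by
    rw [mul_comm, ← smul_eq_mul, ← sum_const]
    refine (sum_le_sum fun σ hσ => h1 σ (mem_filter.1 hσ).2).trans ?_
    exact sum_le_sum_of_subset (filter_subset _ _)
  have h3 : ∑ σ, #(bad σ) = ∑ pq : (Fin (r + 1) → Bool) × BranchIndex (r + 1),
      #{σ : MiniMatching n | Collides σ x₀ (both (A pq.1) (branch x₀ ω k pq.2))} := by
    simp only [bad, card_filter]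
    exact sum_comm
  have h4 : (∑ pq : (Fin (r + 1) → Bool) × BranchIndex (r + 1),
      #{σ : MiniMatching n | Collides σ x₀ (both (A pq.1) (branch x₀ ω k pq.2))} : ℝ) ≤
      (2 ^ (r + 1) * (3 * (r + 2) ^ 2 * 2 ^ (r + 1))) *
        (2 * (K : ℝ) ^ 2 / n * Fintype.card (MiniMatching n)) := by
    refine (sum_le_card_nsmul _ _ _ fun pq _ => card_collides_both_le (K := K) _ _ ?_ hn).trans
      (le_of_eq ?_)
    · have := length_branch_le x₀ ω k pq.2
      simp only [A, followWord, List.length_append, List.length_map, List.length_ofFn,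
        length_followWalk]
      omega
    · rw [card_univ, Fintype.card_prod, card_branchIndex, nsmul_eq_mul]
      simp only [Fintype.card_pi, Fintype.card_bool, prod_const, card_univ, Fintype.card_fin]
      push_cast; ring
  have h5 : (2 : ℝ) ^ r * #{σ : MiniMatching n | #(ballExits σ (walk σ x₀ ω k) r) < 2 ^ r} ≤
      (2 ^ (r + 1) * (3 * (r + 2) ^ 2 * 2 ^ (r + 1))) *
        (2 * (K : ℝ) ^ 2 / n * Fintype.card (MiniMatching n)) := by
    refine le_trans ?_ h4
    exact_mod_cast h3 ▸ h2
  refine le_of_mul_le_mul_left (h5.trans (le_of_eq ?_)) (by positivity : (0 : ℝ) < 2 ^ r)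
  ring

/-! ### Joining two large balls by an edge -/

lemma graphBall_congr {σ σ' : MiniMatching n} {u : Fin n} {r : ℕ}
    (h : ∀ a, collapse a ∈ graphBall σ u r → σ'.1 a = σ.1 a) :
    ∀ l ≤ r + 1, graphBall σ' u l = graphBall σ u l := by
  intro l
  induction l with
  | zero => intro _; rfl
  | succ l ih =>
    intro hl
    have ih := ih (by omega)
    rw [graphBall, graphBall, ih]
    congr 1
    refine image_congr fun a ha => ?_
    rw [h a (graphBall_mono σ u (by omega : l ≤ r) (by simpa using ha))]

/-- The mini-vertices of two balls and their partners. -/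
noncomputable def revealedByBalls (σ : MiniMatching n) (u v : Fin n) (r : ℕ) :
    Finset (Fin (3 * n)) :=
  {a | collapse a ∈ graphBall σ u r ∪ graphBall σ v r ∨
    collapse (σ.1 a) ∈ graphBall σ u r ∪ graphBall σ v r}

lemma mem_revealedByBalls {σ : MiniMatching n} {u v : Fin n} {r : ℕ} {a : Fin (3 * n)} :
    a ∈ revealedByBalls σ u v r ↔ collapse a ∈ graphBall σ u r ∪ graphBall σ v r ∨
      collapse (σ.1 a) ∈ graphBall σ u r ∪ graphBall σ v r := by simp [revealedByBalls]

lemma revealedByBalls_comm (σ : MiniMatching n) (u v : Fin n) (r : ℕ) :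
    revealedByBalls σ u v r = revealedByBalls σ v u r := by
  simp only [revealedByBalls, union_comm]

lemma graphBall_congr_of_revealedByBalls {σ σ' : MiniMatching n} {u v : Fin n} {r : ℕ}
    (h : ∀ a ∈ revealedByBalls σ u v r, σ'.1 a = σ.1 a) {l : ℕ} (hl : l ≤ r + 1) :
    graphBall σ' u l = graphBall σ u l ∧ graphBall σ' v l = graphBall σ v l :=
  ⟨graphBall_congr (fun a ha => h a (by simp [revealedByBalls, ha])) l hl,
    graphBall_congr (fun a ha => h a (by simp [revealedByBalls, ha])) l hl⟩

/-- The two balls agree. A point revealed for `σ'` through its partner in a ball has the same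
partner under `σ`, because `h` applies to that partner. -/
lemma revealedByBalls_congr {σ σ' : MiniMatching n} {u v : Fin n} {r : ℕ}
    (h : ∀ a ∈ revealedByBalls σ u v r, σ'.1 a = σ.1 a) :
    revealedByBalls σ' u v r = revealedByBalls σ u v r := by
  obtain ⟨h1, h2⟩ := graphBall_congr_of_revealedByBalls h (Nat.le_succ r)
  ext a
  have key : a ∈ revealedByBalls σ u v r → a ∈ revealedByBalls σ' u v r := by
    intro ha
    rw [mem_revealedByBalls, h1, h2, h a ha]
    exact mem_revealedByBalls.1 ha
  refine ⟨fun ha => ?_, key⟩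
  rw [mem_revealedByBalls, h1, h2] at ha
  rcases ha with ha | ha
  · exact mem_revealedByBalls.2 (Or.inl ha)
  · have hb := h (σ'.1 a) (mem_revealedByBalls.2 (Or.inl ha))
    rw [σ'.2.1 a] at hb
    refine mem_revealedByBalls.2 (Or.inr ?_)
    rwa [hb, σ.2.1]

/-- Revealing the balls of radius `r` fixes those of radius `r + 1` but leaves the exits of the
latter unmatched: a revealed exit would lead back into its own ball or put the centres too close. -/
lemma ballExits_not_revealed {σ : MiniMatching n} {u v : Fin n} {r : ℕ}
    (hfar : v ∉ graphBall σ u (2 * (r + 1) + 1)) {a : Fin (3 * n)}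
    (ha : a ∈ ballExits σ u (r + 1)) : a ∉ revealedByBalls σ u v r := by
  obtain ⟨_, h1, h2⟩ := mem_filter.1 ha
  rw [mem_revealedByBalls, mem_union, mem_union]
  rintro ((h | h) | (h | h))
  · exact h2 (collapse_partner_mem_graphBall h)
  · exact hfar (graphBall_mono σ u (by omega) (mem_graphBall_trans h1 (mem_graphBall_symm h)))
  · exact h2 (graphBall_subset_succ σ u r h)
  · exact hfar (graphBall_mono σ u (by omega)
      (mem_graphBall_trans (collapse_partner_mem_graphBall h1) (mem_graphBall_symm h)))

/-- Two balls with many exits are at distance at most one, up to an exponentially small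
probability. -/
theorem card_far_apart_le (u v : Fin n) (r M : ℕ) :
    (#{σ : MiniMatching n | v ∉ graphBall σ u (2 * (r + 1) + 1) ∧
        M ≤ #(ballExits σ u (r + 1)) ∧ M ≤ #(ballExits σ v (r + 1))} : ℝ) ≤
      Real.exp (-((M : ℝ) / (3 * n) * (M / 2 : ℕ))) * Fintype.card (MiniMatching n) := by
  refine card_le_of_card_cyl_le (α := Fin (3 * n)) (fun σ => revealedByBalls σ u v r)
    (fun σ σ' h => revealedByBalls_congr h) (fun σ => v ∉ graphBall σ u (2 * (r + 1) + 1) ∧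
      M ≤ #(ballExits σ u (r + 1)) ∧ M ≤ #(ballExits σ v (r + 1))) _ fun σ₀ => ?_
  set D := revealedByBalls σ₀ u v r with hDdef
  rcases ({σ ∈ cyl σ₀ D | v ∉ graphBall σ u (2 * (r + 1) + 1) ∧
      M ≤ #(ballExits σ u (r + 1)) ∧ M ≤ #(ballExits σ v (r + 1))} : Finset _).eq_empty_or_nonempty
    with h0 | ⟨σ₁, h₁⟩
  · rw [h0, card_empty, Nat.cast_zero]; positivity
  · obtain ⟨hσ₁, hfar, hu, hv⟩ := mem_filter.1 h₁
    have hball : ∀ σ ∈ cyl σ₀ D, graphBall σ u (r + 1) = graphBall σ₀ u (r + 1) ∧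
        graphBall σ v (r + 1) = graphBall σ₀ v (r + 1) := fun σ hσ =>
      graphBall_congr_of_revealedByBalls (mem_cyl.1 hσ) le_rfl
    have hD₁ : revealedByBalls σ₁ u v r = D := revealedByBalls_congr (mem_cyl.1 hσ₁)
    have hinv : ∀ a ∈ D, σ₀.1 a ∈ D := fun a ha => by
      rw [mem_revealedByBalls] at ha ⊢
      rw [σ₀.2.1 a]
      exact ha.symm
    -- The exits themselves are not determined by the revealed part. The unmatched points of the
    -- larger balls are, and they contain the exits.
    let S : Finset (Fin (3 * n)) := {a | a ∉ D ∧ collapse a ∈ graphBall σ₀ u (r + 1)}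
    let T : Finset (Fin (3 * n)) := {a | a ∉ D ∧ collapse a ∈ graphBall σ₀ v (r + 1)}
    have hS : M ≤ #S := by
      refine hu.trans (card_le_card fun a ha => ?_)
      refine mem_filter.2 ⟨mem_univ _, hD₁ ▸ ballExits_not_revealed hfar ha, ?_⟩
      rw [← (hball σ₁ hσ₁).1]
      exact (mem_filter.1 ha).2.1
    have hT : M ≤ #T := by
      refine hv.trans (card_le_card fun a ha => ?_)
      have := ballExits_not_revealed (fun h => hfar (mem_graphBall_symm h)) ha
      rw [revealedByBalls_comm, hD₁] at this
      refine mem_filter.2 ⟨mem_univ _, this, ?_⟩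
      rw [← (hball σ₁ hσ₁).2]
      exact (mem_filter.1 ha).2.1
    have hST : Disjoint S T := by
      rw [disjoint_left]
      intro a ha ha'
      have h1 := (mem_filter.1 ha).2.2
      have h2 := (mem_filter.1 ha').2.2
      rw [← (hball σ₁ hσ₁).1] at h1
      rw [← (hball σ₁ hσ₁).2] at h2
      exact hfar (graphBall_mono σ₁ u (by omega) (mem_graphBall_trans h1 (mem_graphBall_symm h2)))
    have hmain : (#{σ ∈ cyl σ₀ D | ∀ s ∈ S, σ.1 s ∉ T} : ℝ) ≤
        (1 - (#T : ℝ) / Fintype.card (Fin (3 * n))) ^ (M / 2) * #(cyl σ₀ D) := by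
      convert card_cyl_no_edge_le T (M / 2) σ₀ D S hinv
        (disjoint_left.2 fun a ha => (mem_filter.1 ha).2.1)
        (disjoint_left.2 fun a ha => (mem_filter.1 ha).2.1) hST (by omega)
    have hsub : ({σ ∈ cyl σ₀ D | v ∉ graphBall σ u (2 * (r + 1) + 1) ∧
        M ≤ #(ballExits σ u (r + 1)) ∧ M ≤ #(ballExits σ v (r + 1))} : Finset _) ⊆
        ({σ ∈ cyl σ₀ D | ∀ s ∈ S, σ.1 s ∉ T} : Finset _) := by
      intro σ hσ
      obtain ⟨hσ, hf, _⟩ := mem_filter.1 hσ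
      refine mem_filter.2 ⟨hσ, fun s hs ht => hf ?_⟩
      have h1 := (mem_filter.1 hs).2.2
      have h2 := (mem_filter.1 ht).2.2
      rw [← (hball σ hσ).1] at h1
      rw [← (hball σ hσ).2] at h2
      exact graphBall_mono σ u (by omega)
        (mem_graphBall_trans (collapse_partner_mem_graphBall h1) (mem_graphBall_symm h2))
    refine (Nat.cast_le.2 (card_le_card hsub)).trans (hmain.trans ?_)
    · gcongr
      have hTN : (#T : ℝ) / Fintype.card (Fin (3 * n)) ≤ 1 :=
        div_le_one_of_le₀ (Nat.cast_le.2 (card_le_univ T)) (by positivity)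
      rw [show -((M : ℝ) / (3 * n) * (M / 2 : ℕ)) = (M / 2 : ℕ) * -((M : ℝ) / (3 * n)) by ring,
        Real.exp_nat_mul]
      refine pow_le_pow_left₀ (by linarith) ?_ _
      refine le_trans ?_ (Real.one_sub_le_exp_neg _)
      rw [Fintype.card_fin]
      push_cast
      gcongr

end Balls

/-! ### Second moment of the reduced length, and the law of the walk -/

section WalkLength

open Classical Finset

variable {n : ℕ}

/-- A finite word, continued by zeros. -/
def extendWord {k : ℕ} (w : Fin k → Fin 3) (j : ℕ) : Fin 3 := if h : j < k then w ⟨j, h⟩ else 0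

namespace Exploration

lemma followWalk_congr (x₀ : Fin n) {ω ω' : ℕ → Fin 3} {k : ℕ} (h : ∀ j < k, ω j = ω' j) :
    followWalk x₀ ω k = followWalk x₀ ω' k := by
  induction k with
  | zero => rfl
  | succ k ih =>
    rw [followWalk, followWalk, ih fun j hj => h j (by omega), h k (by omega)]

lemma walk_congr (σ : MiniMatching n) (x₀ : Fin n) {ω ω' : ℕ → Fin 3} {k : ℕ}
    (h : ∀ j < k, ω j = ω' j) : walk σ x₀ ω k = walk σ x₀ ω' k := by
  rw [← pathEnd_followWalk, ← pathEnd_followWalk, followWalk_congr x₀ h]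

end Exploration

open Exploration

/-- The length of the reduced path of the walk. -/
noncomputable def reducedLength (σ : MiniMatching n) (x₀ : Fin n) (ω : ℕ → Fin 3) (k : ℕ) : ℕ :=
  (path σ (followWalk x₀ ω k)).length

lemma walk_mem_graphBall_reducedLength (σ : MiniMatching n) (x₀ : Fin n) (ω : ℕ → Fin 3) (k : ℕ) :
    walk σ x₀ ω k ∈ graphBall σ x₀ (reducedLength σ x₀ ω k) := by
  rw [← pathEnd_followWalk]
  exact (valid_followWalk ω k).isReducedPath.pathEnd_mem_graphBall

/-- Off the root one choice shortens the path and two lengthen it: the centred increments are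
`-4/3`, `2/3`, `2/3`, with squares adding up to `8/3`. At the root every choice lengthens, but the
deviation `-k / 3` is nonpositive there, so the extra drift gives a cross term of the right sign. -/
lemma sum_sq_pathStep_le (σ : MiniMatching n) (x₀ : Fin n) (s : List (Fin (3 * n))) (k : ℕ) :
    ∑ i, (((pathStep σ s (miniVertex (pathEnd x₀ s) i)).length : ℝ) - (k + 1 : ℕ) / 3) ^ 2 ≤
      3 * ((s.length : ℝ) - k / 3) ^ 2 + 8 / 3 := by
  cases s with
  | nil =>
    simp only [pathStep, List.head?_nil, reduceCtorEq, if_false, List.length_cons, List.length_nil,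
      sum_const, card_univ, Fintype.card_fin, nsmul_eq_mul]
    push_cast
    nlinarith [(Nat.cast_nonneg k : (0 : ℝ) ≤ k)]
  | cons e s =>
    have hlen : ∀ i, ((pathStep σ (e :: s) (miniVertex (pathEnd x₀ (e :: s)) i)).length : ℝ) =
        if i = slot e then (s.length : ℝ) else s.length + 2 := by
      intro i
      have : (e :: s).head? = some (miniVertex (pathEnd x₀ (e :: s)) i) ↔ i = slot e := by
        rw [List.head?_cons, Option.some.injEq]
        conv_lhs => lhs; rw [← miniVertex_collapse_slot e]
        exact ⟨fun h => (miniVertex_injective _ h).symm, fun h => by rw [h]; rfl⟩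
      unfold pathStep
      simp only [this]
      split_ifs
      · rfl
      · simp only [List.length_cons]; push_cast; ring
    simp only [hlen]
    rw [← add_sum_erase univ _ (mem_univ (slot e))]
    rw [sum_congr rfl fun i hi => by rw [if_neg (ne_of_mem_erase hi)], if_pos rfl, sum_const,
      card_erase_of_mem (mem_univ _)]
    simp only [card_univ, Fintype.card_fin, List.length_cons, nsmul_eq_mul]
    push_cast
    nlinarith

/-- The second moment of the deviation of the reduced length from a third of the time. -/
lemma sum_sq_reducedLength_le (σ : MiniMatching n) (x₀ : Fin n) (k : ℕ) :
    ∑ w : Fin k → Fin 3, (((reducedLength σ x₀ (extendWord w) k : ℝ) - k / 3) ^ 2 : ℝ) ≤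
      8 / 9 * (k : ℝ) * 3 ^ k := by
  induction k with
  | zero => simp [reducedLength, followWalk, path]
  | succ k ih =>
    rw [← (Fin.snocEquiv fun _ => Fin 3).sum_comp, Fintype.sum_prod_type_right]
    have hstep : ∀ (w : Fin k → Fin 3) (i : Fin 3),
        reducedLength σ x₀ (extendWord (Fin.snocEquiv (fun _ => Fin 3) (i, w))) (k + 1) =
          (pathStep σ (path σ (followWalk x₀ (extendWord w) k))
            (miniVertex (pathEnd x₀ (path σ (followWalk x₀ (extendWord w) k))) i)).length := by
      intro w i
      have h1 : followWalk x₀ (extendWord (Fin.snocEquiv (fun _ => Fin 3) (i, w))) k =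
          followWalk x₀ (extendWord w) k := by
        refine followWalk_congr x₀ fun j hj => ?_
        simp [extendWord, Fin.snocEquiv, Fin.snoc, hj, Nat.lt_succ_of_lt hj]
      have h2 : extendWord (Fin.snocEquiv (fun _ => Fin 3) (i, w)) k = i := by
        simp [extendWord, Fin.snocEquiv, Fin.snoc]
      rw [reducedLength, followWalk, path, h1, h2, Option.elim_some]
    simp only [hstep]
    refine (sum_le_sum fun w _ => sum_sq_pathStep_le σ x₀ _ k).trans ?_
    rw [sum_add_distrib, ← mul_sum]
    simp only [reducedLength] at ih
    simp only [sum_const, card_univ, Fintype.card_pi, Fintype.card_fin, prod_const, nsmul_eq_mul]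
    push_cast
    rw [pow_succ]
    nlinarith

lemma card_reducedLength_deviation_le (σ : MiniMatching n) (x₀ : Fin n) (k : ℕ) {a : ℝ}
    (ha : 0 < a) :
    (#{w : Fin k → Fin 3 | a ≤ |(reducedLength σ x₀ (extendWord w) k : ℝ) - k / 3|} : ℝ) ≤
      8 / 9 * k / a ^ 2 * 3 ^ k := by
  have h1 : (#{w : Fin k → Fin 3 | a ≤ |(reducedLength σ x₀ (extendWord w) k : ℝ) - k / 3|} : ℝ) *
      a ^ 2 ≤ 8 / 9 * k * 3 ^ k := by
    refine le_trans ?_ (sum_sq_reducedLength_le σ x₀ k)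
    rw [← nsmul_eq_mul]
    refine (card_nsmul_le_sum _ _ _ fun w hw => ?_).trans
      (sum_le_sum_of_subset_of_nonneg (filter_subset _ _) fun _ _ _ => sq_nonneg _)
    rw [← sq_abs (_ - _)]
    exact pow_le_pow_left₀ ha.le (mem_filter.1 hw).2 2
  rw [div_mul_eq_mul_div, le_div_iff₀ (by positivity)]
  exact h1

/-- An event that depends on the first `k` choices has small probability when it holds for a small
proportion of the matchings and words. -/
lemma walkMeasure_real_le {k : ℕ} (Q : MiniMatching n → (Fin k → Fin 3) → Prop) {c : ℝ}
    (h : (#{q : MiniMatching n × (Fin k → Fin 3) | Q q.1 q.2} : ℝ) ≤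
      c * (Fintype.card (MiniMatching n) * 3 ^ k)) (hc : 0 ≤ c) :
    (walkMeasure n).real {p | Q p.1 fun j => p.2 j} ≤ c := by
  -- A finite cover by cylinders of equal mass suffices for an upper bound, so measurability of the
  -- event plays no role.
  have hsub : {p : MiniMatching n × (ℕ → Fin 3) | Q p.1 fun j => p.2 j} ⊆
      ⋃ q ∈ (({q | Q q.1 q.2} : Finset (MiniMatching n × (Fin k → Fin 3)))),
        ({q.1} : Set (MiniMatching n)) ×ˢ
          (Set.pi (Finset.range k : Set ℕ) fun j => ({extendWord q.2 j} : Set (Fin 3))) := by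
    rintro ⟨σ, ω⟩ hp
    simp only [Set.mem_iUnion]
    refine ⟨(σ, fun j => ω j), mem_filter.2 ⟨mem_univ _, hp⟩, rfl, fun j hj => ?_⟩
    have hj : j < k := by simpa using hj
    simp [extendWord, hj]
  have hmeas : ∀ q : MiniMatching n × (Fin k → Fin 3), walkMeasure n
      (({q.1} : Set (MiniMatching n)) ×ˢ
        (Set.pi (Finset.range k : Set ℕ) fun j => ({extendWord q.2 j} : Set (Fin 3)))) =
      ENNReal.ofReal (1 / (Fintype.card (MiniMatching n) * 3 ^ k)) := by
    intro q
    have hpos : 0 < Fintype.card (MiniMatching n) := Fintype.card_pos_iff.2 ⟨q.1⟩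
    rw [walkMeasure, Measure.prod_prod, Measure.infinitePi_pi]
    · have h1 : ProbabilityTheory.uniformOn (Set.univ : Set (MiniMatching n)) {q.1} =
          ENNReal.ofReal (1 / Fintype.card (MiniMatching n)) := by
        rw [ProbabilityTheory.uniformOn_univ, Measure.count_singleton, one_div, one_div,
          ENNReal.ofReal_inv_of_pos (by exact_mod_cast hpos), ENNReal.ofReal_natCast]
      have h2 : ∀ i : Fin 3, ProbabilityTheory.uniformOn (Set.univ : Set (Fin 3)) {i} =
          ENNReal.ofReal (1 / 3) := by
        intro i
        rw [ProbabilityTheory.uniformOn_univ, Measure.count_singleton, one_div, one_div,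
          ENNReal.ofReal_inv_of_pos (by norm_num)]
        simp
      rw [h1]
      simp only [h2, prod_const, card_range]
      rw [← ENNReal.ofReal_pow (by norm_num), ← ENNReal.ofReal_mul (by positivity)]
      congr 1
      rw [div_pow, one_pow, div_mul_div_comm, one_mul]
    · intro i _; exact measurableSet_singleton _
  rw [measureReal_def]
  refine ENNReal.toReal_le_of_le_ofReal hc ?_
  refine (measure_mono hsub).trans ((measure_biUnion_finset_le _ _).trans ?_)
  rw [sum_congr rfl fun q _ => hmeas q, sum_const, nsmul_eq_mul, ← ENNReal.ofReal_natCast,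
    ← ENNReal.ofReal_mul (by positivity)]
  refine ENNReal.ofReal_le_ofReal ?_
  rw [mul_one_div]
  exact div_le_of_le_mul₀ (by positivity) hc h

end WalkLength

/-! ### Combination of the estimates -/

section Main

open Classical Finset

variable {n : ℕ}

lemma card_filter_prod_le {k : ℕ} (Q : MiniMatching n → (Fin k → Fin 3) → Prop) {c : ℝ}
    (h : ∀ w, (#{σ : MiniMatching n | Q σ w} : ℝ) ≤ c * Fintype.card (MiniMatching n)) :
    (#{q : MiniMatching n × (Fin k → Fin 3) | Q q.1 q.2} : ℝ) ≤
      c * (Fintype.card (MiniMatching n) * 3 ^ k) := by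
  have h1 : #{q : MiniMatching n × (Fin k → Fin 3) | Q q.1 q.2} =
      ∑ w, #{σ : MiniMatching n | Q σ w} := by
    simp only [card_filter]
    rw [Fintype.sum_prod_type_right]
  rw [h1]
  push_cast
  refine (sum_le_card_nsmul _ _ _ fun w _ => h w).trans (le_of_eq ?_)
  simp only [card_univ, Fintype.card_pi, Fintype.card_fin, prod_const, nsmul_eq_mul]
  push_cast; ring

lemma card_filter_prod_le' {k : ℕ} (Q : MiniMatching n → (Fin k → Fin 3) → Prop) {c : ℝ}
    (h : ∀ σ, (#{w | Q σ w} : ℝ) ≤ c * 3 ^ k) :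
    (#{q : MiniMatching n × (Fin k → Fin 3) | Q q.1 q.2} : ℝ) ≤
      c * (Fintype.card (MiniMatching n) * 3 ^ k) := by
  have h1 : #{q : MiniMatching n × (Fin k → Fin 3) | Q q.1 q.2} = ∑ σ, #{w | Q σ w} := by
    simp only [card_filter]
    rw [Fintype.sum_prod_type]
  rw [h1]
  push_cast
  refine (sum_le_card_nsmul _ _ _ fun σ _ => h σ).trans (le_of_eq ?_)
  rw [card_univ, nsmul_eq_mul]; ring

lemma card_filter_or_le {β : Type*} [Fintype β] {P Q : β → Prop} [DecidablePred P]
    [DecidablePred Q] {a b : ℝ} (hP : (#{x | P x} : ℝ) ≤ a) (hQ : (#{x | Q x} : ℝ) ≤ b) :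
    (#{x | P x ∨ Q x} : ℝ) ≤ a + b := by
  refine le_trans ?_ (add_le_add hP hQ)
  rw [filter_or]
  exact_mod_cast card_union_le _ _

lemma card_filter_le_of_iff {β : Type*} [Fintype β] {P Q : β → Prop} [DecidablePred P]
    [DecidablePred Q] (h : ∀ x, P x ↔ Q x) {c : ℝ} (hQ : (#{x | Q x} : ℝ) ≤ c) :
    (#{x | P x} : ℝ) ≤ c := by
  rwa [filter_congr fun x _ => h x]

/-- The position of the walk depends on the matching, so `card_far_apart_le`, which is for fixed
centres, is summed over all `v`. -/
lemma card_exists_far_apart_le (u : Fin n) (r : ℕ) :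
    (#{σ : MiniMatching n | ∃ v, v ∉ graphBall σ u (2 * (r + 1) + 1) ∧
        2 ^ (r + 1) ≤ #(ballExits σ u (r + 1)) ∧ 2 ^ (r + 1) ≤ #(ballExits σ v (r + 1))} : ℝ) ≤
      n * Real.exp (-((2 : ℝ) ^ (r + 1) / (3 * n) * 2 ^ r)) * Fintype.card (MiniMatching n) := by
  have hsub : ({σ : MiniMatching n | ∃ v, v ∉ graphBall σ u (2 * (r + 1) + 1) ∧
      2 ^ (r + 1) ≤ #(ballExits σ u (r + 1)) ∧ 2 ^ (r + 1) ≤ #(ballExits σ v (r + 1))} :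
        Finset _) ⊆ (univ : Finset (Fin n)).biUnion fun v =>
      {σ : MiniMatching n | v ∉ graphBall σ u (2 * (r + 1) + 1) ∧
        2 ^ (r + 1) ≤ #(ballExits σ u (r + 1)) ∧ 2 ^ (r + 1) ≤ #(ballExits σ v (r + 1))} := by
    intro σ hσ
    obtain ⟨v, hv⟩ := (mem_filter.1 hσ).2
    exact mem_biUnion.2 ⟨v, mem_univ _, mem_filter.2 ⟨mem_univ _, hv⟩⟩
  refine (Nat.cast_le.2 ((card_le_card hsub).trans card_biUnion_le)).trans ?_
  rw [Nat.cast_sum]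
  refine (sum_le_card_nsmul _ _ _ fun v _ => card_far_apart_le u v r (2 ^ (r + 1))).trans
    (le_of_eq ?_)
  rw [card_univ, Fintype.card_fin, nsmul_eq_mul, pow_succ, Nat.mul_div_cancel _ two_pos, ← mul_assoc]
  push_cast [pow_succ]; rfl

/-- The distance from the starting point lies between `ℓ` and the minimum of `k / 3 + a` and
`2 * r + 3`, up to an explicit probability. -/
theorem walkMeasure_real_walkDist_le (x₀ : Fin n) (k ℓ r K : ℕ) {a : ℝ} (ha : 0 < a)
    (hℓ : ℓ ≤ k / 3 - a) (hK₁ : k + 2 * ℓ + 1 ≤ K) (hK₂ : 2 * k + 3 * (r + 2) + 1 ≤ K)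
    (hn : 2 * K ≤ n) :
    (walkMeasure n).real {p | ¬ (ℓ < walkDist p.1 x₀ p.2 k ∧
        (walkDist p.1 x₀ p.2 k : ℝ) < k / 3 + a ∧ walkDist p.1 x₀ p.2 k ≤ 2 * r + 3)} ≤
      8 / 9 * k / a ^ 2 + (3 * (ℓ + 1) ^ 2 * 2 ^ ℓ) * (2 * (K : ℝ) ^ 2 / n) +
        2 * (2 * (3 * (r + 3) ^ 2 * 2 ^ (r + 2)) * (2 * (K : ℝ) ^ 2 / n)) +
        n * Real.exp (-((2 : ℝ) ^ (r + 1) / (3 * n) * 2 ^ r)) := by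
  let c₃ : ℝ := 2 * (3 * (r + 3) ^ 2 * 2 ^ (r + 2)) * (2 * (K : ℝ) ^ 2 / n)
  -- Excluding `E₁` controls the reduced length, which gives the bound `k / 3 + a`; excluding `E₂`
  -- as well gives the lower bound `ℓ`; excluding `E₃`, `E₄`, `E₅` gives the cap `2 * r + 3`. The
  -- estimate of `E₁` averages over words for a fixed matching, the others over matchings for a
  -- fixed word.
  obtain ⟨E₁, hE₁⟩ : ∃ E : MiniMatching n → (Fin k → Fin 3) → Prop, ∀ σ w, E σ w ↔
    a ≤ |(reducedLength σ x₀ (extendWord w) k : ℝ) - k / 3| := ⟨_, fun _ _ => Iff.rfl⟩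
  obtain ⟨E₂, hE₂⟩ : ∃ E : MiniMatching n → (Fin k → Fin 3) → Prop, ∀ σ w, E σ w ↔
    walk σ x₀ (extendWord w) k ∈ graphBall σ x₀ ℓ ∧ ℓ < reducedLength σ x₀ (extendWord w) k :=
    ⟨_, fun _ _ => Iff.rfl⟩
  obtain ⟨E₃, hE₃⟩ : ∃ E : MiniMatching n → (Fin k → Fin 3) → Prop, ∀ σ w, E σ w ↔
    #(ballExits σ (walk σ x₀ (extendWord w) k) (r + 1)) < 2 ^ (r + 1) := ⟨_, fun _ _ => Iff.rfl⟩
  obtain ⟨E₄, hE₄⟩ : ∃ E : MiniMatching n → (Fin k → Fin 3) → Prop, ∀ σ w, E σ w ↔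
    #(ballExits σ x₀ (r + 1)) < 2 ^ (r + 1) := ⟨_, fun _ _ => Iff.rfl⟩
  obtain ⟨E₅, hE₅⟩ : ∃ E : MiniMatching n → (Fin k → Fin 3) → Prop, ∀ σ w, E σ w ↔
    ∃ v, v ∉ graphBall σ x₀ (2 * (r + 1) + 1) ∧ 2 ^ (r + 1) ≤ #(ballExits σ x₀ (r + 1)) ∧
      2 ^ (r + 1) ≤ #(ballExits σ v (r + 1)) := ⟨_, fun _ _ => Iff.rfl⟩
  have h₁ := card_filter_prod_le' E₁ fun σ =>
    card_filter_le_of_iff (hE₁ σ) (card_reducedLength_deviation_le σ x₀ k ha)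
  have h₂ := card_filter_prod_le E₂ fun w => card_filter_le_of_iff (fun σ => hE₂ σ w)
    (card_walk_mem_graphBall_le x₀ (extendWord w) k ℓ hK₁ hn)
  have h₃ := card_filter_prod_le E₃ fun w => card_filter_le_of_iff (fun σ => hE₃ σ w)
    (card_ballExits_small_le x₀ (extendWord w) k (r + 1) (K := K) (by omega) hn)
  have h₄ := card_filter_prod_le E₄ fun w => card_filter_le_of_iff (fun σ => hE₄ σ w)
    (card_ballExits_small_le x₀ (extendWord w) 0 (r + 1) (K := K) (by omega) hn)
  have h₅ := card_filter_prod_le E₅ fun w => card_filter_le_of_iff (fun σ => hE₅ σ w)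
    (card_exists_far_apart_le x₀ r)
  have hall := card_filter_or_le h₁ (card_filter_or_le h₂ (card_filter_or_le h₃
    (card_filter_or_le h₄ h₅)))
  have hext : ∀ ω : ℕ → Fin 3, ∀ j < k, extendWord (fun i : Fin k => ω i) j = ω j := by
    intro ω j hj; simp [extendWord, hj]
  have hgood : ∀ (σ : MiniMatching n) (w : Fin k → Fin 3),
      ¬ (E₁ σ w ∨ E₂ σ w ∨ E₃ σ w ∨ E₄ σ w ∨ E₅ σ w) →
      ℓ < walkDist σ x₀ (extendWord w) k ∧ (walkDist σ x₀ (extendWord w) k : ℝ) < k / 3 + a ∧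
        walkDist σ x₀ (extendWord w) k ≤ 2 * r + 3 := by
    intro σ w h
    simp only [not_or] at h
    obtain ⟨g₁, g₂, g₃, g₄, g₅⟩ := h
    rw [hE₁, not_le, abs_lt] at g₁
    have hR := walk_mem_graphBall_reducedLength σ x₀ (extendWord w) k
    have hDR : walkDist σ x₀ (extendWord w) k ≤ reducedLength σ x₀ (extendWord w) k :=
      dist_le_of_mem_graphBall hR
    refine ⟨?_, ?_, ?_⟩
    · by_contra hlt
      refine g₂ ((hE₂ σ w).2 ⟨graphBall_mono σ x₀ (not_lt.1 hlt) (mem_graphBall_dist hR), ?_⟩)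
      have : (ℓ : ℝ) < reducedLength σ x₀ (extendWord w) k := by linarith [g₁.1]
      exact_mod_cast this
    · have : (walkDist σ x₀ (extendWord w) k : ℝ) ≤ reducedLength σ x₀ (extendWord w) k := by
        exact_mod_cast hDR
      linarith [g₁.2]
    · by_contra hlt
      rw [hE₃, not_lt] at g₃
      rw [hE₄, not_lt] at g₄
      refine g₅ ((hE₅ σ w).2 ⟨walk σ x₀ (extendWord w) k, fun hmem => hlt ?_, g₄, g₃⟩)
      exact (dist_le_of_mem_graphBall hmem).trans (by omega)
  obtain ⟨Q, hQ⟩ : ∃ Q : MiniMatching n → (Fin k → Fin 3) → Prop, ∀ σ w, Q σ w ↔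
    ¬ (ℓ < walkDist σ x₀ (extendWord w) k ∧ (walkDist σ x₀ (extendWord w) k : ℝ) < k / 3 + a ∧
      walkDist σ x₀ (extendWord w) k ≤ 2 * r + 3) := ⟨_, fun _ _ => Iff.rfl⟩
  have hset : {p : MiniMatching n × (ℕ → Fin 3) | ¬ (ℓ < walkDist p.1 x₀ p.2 k ∧
        (walkDist p.1 x₀ p.2 k : ℝ) < k / 3 + a ∧ walkDist p.1 x₀ p.2 k ≤ 2 * r + 3)} =
      {p | Q p.1 fun j : Fin k => p.2 j} := by
    refine Set.ext fun p => ?_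
    have : walkDist p.1 x₀ (extendWord fun j : Fin k => p.2 j) k = walkDist p.1 x₀ p.2 k := by
      rw [walkDist, walkDist, Exploration.walk_congr _ _ (hext p.2)]
    have h := hQ p.1 fun j : Fin k => p.2 j
    rw [this] at h
    exact h.symm
  rw [hset]
  refine walkMeasure_real_le Q ?_ (by positivity)
  refine le_trans (Nat.cast_le.2 (card_le_card ?_)) (hall.trans (le_of_eq ?_))
  · intro q hq
    refine mem_filter.2 ⟨mem_univ _, ?_⟩
    by_contra hb
    exact (hQ q.1 q.2).1 (mem_filter.1 hq).2 (hgood q.1 q.2 hb)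
  · push_cast; ring

/-! ### Choice of parameters and asymptotics -/

lemma tendsto_pow_mul_two_rpow_neg {b : ℝ} (hb : 0 < b) (m : ℕ) :
    Tendsto (fun x : ℝ => x ^ m * (2 : ℝ) ^ (-(b * x))) atTop (nhds 0) := by
  have h := tendsto_rpow_mul_exp_neg_mul_atTop_nhds_zero m (b * Real.log 2)
    (mul_pos hb (Real.log_pos one_lt_two))
  refine h.congr fun x => ?_
  rw [Real.rpow_natCast, Real.rpow_def_of_pos two_pos]
  congr 2; ring

lemma tendsto_two_rpow_mul_exp_neg {b c : ℝ} (hb : 0 < b) (hc : 0 < c) :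
    Tendsto (fun x : ℝ => (2 : ℝ) ^ x * Real.exp (-(c * 2 ^ (b * x)))) atTop (nhds 0) := by
  have h := tendsto_rpow_mul_exp_neg_mul_atTop_nhds_zero (1 / b) c hc
  have h2 : Tendsto (fun x : ℝ => (2 : ℝ) ^ (b * x)) atTop atTop :=
    (tendsto_rpow_atTop_of_base_gt_one 2 one_lt_two).comp (tendsto_id.const_mul_atTop hb)
  refine (h.comp h2).congr fun x => ?_
  simp only [Function.comp]
  rw [← Real.rpow_mul two_pos.le, neg_mul]
  congr 2
  field_simp

/-- The bound on the exceptional probability, as a function of `L = log₂ n`. -/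
noncomputable def exceptionalBound (t ε L : ℝ) : ℝ :=
  32 * t / (9 * ε ^ 2) * L⁻¹ + 24 * (2 * t + 16) ^ 2 * (L ^ 4 * 2 ^ (-(ε * L))) +
    1536 * (2 * t + 16) ^ 2 * (L ^ 4 * 2 ^ (-(1 / 3 * L))) +
    2 ^ L * Real.exp (-(1 / 6 * 2 ^ (2 / 3 * ε * L)))

lemma tendsto_exceptionalBound (t : ℝ) {ε : ℝ} (hε : 0 < ε) :
    Tendsto (exceptionalBound t ε) atTop (nhds 0) := by
  have h := (((tendsto_inv_atTop_zero (𝕜 := ℝ)).const_mul (32 * t / (9 * ε ^ 2))).add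
    ((tendsto_pow_mul_two_rpow_neg hε 4).const_mul (24 * (2 * t + 16) ^ 2))).add
    ((tendsto_pow_mul_two_rpow_neg (b := 1 / 3) (by norm_num) 4).const_mul
      (1536 * (2 * t + 16) ^ 2)) |>.add
    (tendsto_two_rpow_mul_exp_neg (b := 2 / 3 * ε) (c := 1 / 6) (by positivity) (by norm_num))
  change Tendsto (fun L => exceptionalBound t ε L) atTop (nhds 0)
  unfold exceptionalBound
  simpa only [mul_zero, add_zero] using h

lemma two_pow_le_two_rpow {m : ℕ} {y : ℝ} (h : (m : ℝ) ≤ y) : (2 : ℝ) ^ m ≤ 2 ^ y := by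
  rw [← Real.rpow_natCast]
  exact Real.rpow_le_rpow_of_exponent_le one_le_two h

lemma short_word_bound_le {A L ε : ℝ} {ℓ K n : ℕ} (hL₁ : 1 ≤ L) (hnL : (2 : ℝ) ^ L = n)
    (hℓL : (ℓ : ℝ) ≤ L) (hℓ : (ℓ : ℝ) ≤ L + -(ε * L)) (hK : (K : ℝ) ≤ A * L) :
    (3 * ((ℓ : ℝ) + 1) ^ 2 * 2 ^ ℓ) * (2 * (K : ℝ) ^ 2 / n) ≤
      24 * A ^ 2 * (L ^ 4 * 2 ^ (-(ε * L))) := by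
  have h2 := two_pow_le_two_rpow hℓ
  rw [Real.rpow_add two_pos] at h2
  rw [← hnL]
  have hX : (0 : ℝ) < 2 ^ L := by positivity
  calc (3 * ((ℓ : ℝ) + 1) ^ 2 * 2 ^ ℓ) * (2 * (K : ℝ) ^ 2 / 2 ^ L) ≤
      (3 * (L + L) ^ 2 * (2 ^ L * 2 ^ (-(ε * L)))) * (2 * (A * L) ^ 2 / 2 ^ L) := by
        gcongr
    _ = _ := by field_simp; ring

lemma branch_bound_le {A L : ℝ} {r K n : ℕ} (hL₁ : 1 ≤ L) (hnL : (2 : ℝ) ^ L = n)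
    (hrL : (r : ℝ) ≤ L) (hr : (r : ℝ) ≤ L + -(1 / 3 * L)) (hK : (K : ℝ) ≤ A * L) :
    2 * (2 * (3 * ((r : ℝ) + 3) ^ 2 * 2 ^ (r + 2)) * (2 * (K : ℝ) ^ 2 / n)) ≤
      1536 * A ^ 2 * (L ^ 4 * 2 ^ (-(1 / 3 * L))) := by
  have h2 := two_pow_le_two_rpow hr
  rw [Real.rpow_add two_pos] at h2
  rw [← hnL, pow_add]
  have hX : (0 : ℝ) < 2 ^ L := by positivity
  have h3 : (r : ℝ) + 3 ≤ 4 * L := by linarith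
  calc 2 * (2 * (3 * ((r : ℝ) + 3) ^ 2 * (2 ^ r * 2 ^ 2)) * (2 * (K : ℝ) ^ 2 / 2 ^ L)) ≤
      2 * (2 * (3 * (4 * L) ^ 2 * ((2 ^ L * 2 ^ (-(1 / 3 * L))) * 2 ^ 2)) *
        (2 * (A * L) ^ 2 / 2 ^ L)) := by
        gcongr
    _ = _ := by field_simp; ring

/-- The exponent is `4 ^ (r + 1) / (6 * n)`. Taking `r + 1` above `L / 2` by `ε * L / 3` makes it a
positive power of `n`, enough to absorb the factor `n`. -/
lemma far_apart_bound_le {L ε : ℝ} {r n : ℕ} (hnL : (2 : ℝ) ^ L = n)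
    (hr : (1 / 2 + ε / 3) * L ≤ r + 1) :
    n * Real.exp (-((2 : ℝ) ^ (r + 1) / (3 * n) * 2 ^ r)) ≤
      2 ^ L * Real.exp (-(1 / 6 * 2 ^ (2 / 3 * ε * L))) := by
  have h1 : (2 : ℝ) ^ ((1 / 2 + ε / 3) * L) ≤ 2 ^ (r + 1) := by
    rw [← Real.rpow_natCast]
    exact Real.rpow_le_rpow_of_exponent_le one_le_two (by push_cast; exact hr)
  have h2 : (2 : ℝ) ^ (2 / 3 * ε * L) =
      2 ^ ((1 / 2 + ε / 3) * L) * 2 ^ ((1 / 2 + ε / 3) * L) / 2 ^ L := by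
    rw [← Real.rpow_add two_pos, ← Real.rpow_sub two_pos]
    congr 1; ring
  have h3 : (1 / 6 : ℝ) * 2 ^ (2 / 3 * ε * L) ≤ (2 : ℝ) ^ (r + 1) / (3 * 2 ^ L) * 2 ^ r := by
    have hX : (0 : ℝ) < 2 ^ L := by positivity
    calc (1 / 6 : ℝ) * 2 ^ (2 / 3 * ε * L) ≤ 1 / 6 * (2 ^ (r + 1) * 2 ^ (r + 1) / 2 ^ L) := by
          rw [h2]; gcongr
      _ = _ := by rw [pow_succ]; field_simp; ring
  rw [← hnL]
  exact mul_le_mul_of_nonneg_left (Real.exp_le_exp.2 (neg_le_neg h3)) (by positivity)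

lemma walkMeasure_real_deviation_le {t ε L : ℝ} (ht : 0 < t) (hε : 0 < ε) (hε₁ : ε ≤ 1 / 2)
    (hε₂ : ε ≤ t / 3) (hL : L = Real.logb 2 n) (hL₁ : 1 ≤ L) (hL₂ : 9 < ε * L)
    (hn : 2 * ((2 * t + 16) * L) ≤ n) (x₀ : Fin n) :
    (walkMeasure n).real {p | ε ≤ |(walkDist p.1 x₀ p.2 ⌊t * L⌋₊ : ℝ) / L - min (t / 3) 1|} ≤
      exceptionalBound t ε L := by
  have hn0 : (0 : ℝ) < n := by
    have := x₀.pos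
    exact_mod_cast this
  have hnL : (2 : ℝ) ^ L = n := by rw [hL]; exact Real.rpow_logb two_pos (by norm_num) hn0
  have hL0 : 0 < L := by linarith
  set c := min (t / 3) 1 with hc
  have hcε : 0 ≤ c - ε := sub_nonneg.2 (le_min hε₂ (by linarith))
  have hct : c ≤ t / 3 := min_le_left _ _
  have hc1 : c ≤ 1 := min_le_right _ _
  set k := ⌊t * L⌋₊ with hk
  set ℓ := ⌊(c - ε) * L⌋₊ with hℓ
  -- Then `2 * r + 3 ≤ (1 + 2 * ε / 3) * L + 3`, which is below `(1 + ε) * L` since `ε * L > 9`. The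
  -- condition `ε ≤ 1 / 2` keeps `r ≤ 2 / 3 * L`, so the balls still have many exits.
  set r := ⌊(1 / 2 + ε / 3) * L⌋₊ with hr
  -- A common bound, with room to spare, for the lengths of all explorations used.
  set K := ⌊(2 * t + 16) * L⌋₊ with hK
  have hk₁ : (k : ℝ) ≤ t * L := Nat.floor_le (by positivity)
  have hk₂ : t * L - 1 < k := Nat.sub_one_lt_floor _
  have hℓ₁ : (ℓ : ℝ) ≤ (c - ε) * L := Nat.floor_le (by positivity)
  have hr₁ : (r : ℝ) ≤ (1 / 2 + ε / 3) * L := Nat.floor_le (by positivity)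
  have hr₂ : (1 / 2 + ε / 3) * L < r + 1 := Nat.lt_floor_add_one _
  have hK₁ : (K : ℝ) ≤ (2 * t + 16) * L := Nat.floor_le (by positivity)
  have hcL : c * L ≤ 1 * L := mul_le_mul_of_nonneg_right hc1 hL0.le
  have hctL : c * L ≤ t / 3 * L := mul_le_mul_of_nonneg_right hct hL0.le
  have hεL : ε * L ≤ 1 / 2 * L := mul_le_mul_of_nonneg_right hε₁ hL0.le
  have htL : 0 < t * L := by positivity
  have hrL : (r : ℝ) ≤ L := hr₁.trans (by linarith)
  have hℓL : (ℓ : ℝ) ≤ L := hℓ₁.trans (by linarith)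
  have hmain := walkMeasure_real_walkDist_le x₀ k ℓ r K (a := ε * L / 2) (by positivity)
    (by linarith)
    (Nat.le_floor (by push_cast; linarith)) (Nat.le_floor (by push_cast; linarith))
    (by
      have : (2 * K : ℝ) ≤ n := by linarith
      exact_mod_cast this)
  have hfin : (walkMeasure n) {p | ¬ (ℓ < walkDist p.1 x₀ p.2 k ∧
        (walkDist p.1 x₀ p.2 k : ℝ) < k / 3 + ε * L / 2 ∧
        walkDist p.1 x₀ p.2 k ≤ 2 * r + 3)} ≠ ⊤ := by
    unfold walkMeasure
    exact measure_ne_top _ _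
  refine (measureReal_mono (fun p hp hgood => ?_) hfin).trans (hmain.trans ?_)
  · obtain ⟨g₁, g₂, g₃⟩ := hgood
    have hp : ε ≤ |(walkDist p.1 x₀ p.2 k : ℝ) / L - c| := hp
    have g₃' : (walkDist p.1 x₀ p.2 k : ℝ) ≤ 2 * r + 3 := by exact_mod_cast g₃
    rcases le_abs.1 hp with h | h
    · have h' : c + ε ≤ (walkDist p.1 x₀ p.2 k : ℝ) / L := by linarith
      rw [le_div_iff₀ hL0] at h'
      rcases min_choice (t / 3) 1 with h0 | h0
      · rw [← hc] at h0
        rw [h0] at h'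
        linarith
      · rw [← hc] at h0
        rw [h0] at h'
        linarith
    · have h' : (walkDist p.1 x₀ p.2 k : ℝ) / L ≤ c - ε := by linarith
      rw [div_le_iff₀ hL0] at h'
      exact absurd (Nat.le_floor h') (not_le.2 g₁)
  · unfold exceptionalBound
    refine add_le_add (add_le_add (add_le_add ?_ ?_) ?_) ?_
    · calc 8 / 9 * (k : ℝ) / (ε * L / 2) ^ 2 ≤ 8 / 9 * (t * L) / (ε * L / 2) ^ 2 := by gcongr
        _ = _ := by field_simp; ring
    · exact short_word_bound_le hL₁ hnL hℓL (hℓ₁.trans (by linarith)) hK₁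
    · exact branch_bound_le hL₁ hnL hrL (hr₁.trans (by linarith)) hK₁
    · exact far_apart_bound_le hnL hr₂.le

end Main

theorem theorem5 (t : ℝ) (ht : 0 < t) :
    ∀ ε : ℝ, 0 < ε → ∀ δ : ℝ, 0 < δ →
      ∀ᶠ n : ℕ in atTop, Even n → ∀ x₀ : Fin n,
        (walkMeasure n).real
          {p | ε ≤ |(walkDist p.1 x₀ p.2 ⌊t * Real.logb 2 n⌋₊ : ℝ) / Real.logb 2 n
                    - min (t / 3) 1|} ≤ δ := by
  intro ε hε δ hδ
  -- Shrinking `ε` enlarges the exceptional event, so the smallness conditions of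
  -- `walkMeasure_real_deviation_le` cost nothing.
  set ε' := min ε (min (1 / 2) (t / 3)) with hε'
  have hε'0 : 0 < ε' := by positivity
  have hlog : Tendsto (fun n : ℕ => Real.logb 2 n) atTop atTop :=
    (Real.tendsto_logb_atTop one_lt_two).comp tendsto_natCast_atTop_atTop
  have h1 : ∀ᶠ L : ℝ in atTop, exceptionalBound t ε' L < δ :=
    (tendsto_exceptionalBound t hε'0).eventually_lt_const hδ
  have h2 : ∀ᶠ L : ℝ in atTop, L ^ 1 * (2 : ℝ) ^ (-(1 * L)) < 1 / (2 * (2 * t + 16)) :=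
    (tendsto_pow_mul_two_rpow_neg one_pos 1).eventually_lt_const (by positivity)
  have h3 : ∀ᶠ L : ℝ in atTop, 9 < ε' * L :=
    (tendsto_id.const_mul_atTop hε'0).eventually_gt_atTop 9
  filter_upwards [hlog.eventually h1, hlog.eventually h2, hlog.eventually h3,
    hlog.eventually_ge_atTop 1, eventually_gt_atTop 0] with n g1 g2 g3 g4 g5 _ x₀
  have hn0 : (0 : ℝ) < n := by exact_mod_cast g5
  have hbig : 2 * ((2 * t + 16) * Real.logb 2 n) ≤ n := by
    rw [pow_one, one_mul, Real.rpow_neg two_pos.le, Real.rpow_logb two_pos (by norm_num) hn0,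
      ← div_eq_mul_inv, div_lt_div_iff₀ hn0 (by positivity)] at g2
    linarith
  refine le_trans (measureReal_mono (fun p hp => ?_) ?_)
    ((walkMeasure_real_deviation_le (ε := ε') ht hε'0 ((min_le_right _ _).trans (min_le_left _ _))
      ((min_le_right _ _).trans (min_le_right _ _)) rfl g4 g3 hbig x₀).trans g1.le)
  · have hp : ε ≤ |(walkDist p.1 x₀ p.2 ⌊t * Real.logb 2 n⌋₊ : ℝ) / Real.logb 2 n -
      min (t / 3) 1| := hp
    exact (min_le_left _ _).trans hp
  · unfold walkMeasure
    exact measure_ne_top _ _
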